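/- Let $\mathbb D$ be the open unit disc, $\rho(z,w)=\left|\frac{z-w}{1-\bar w z}\right|$ the pseudo-hyperbolic distance, and $m$ the normalized Lebesgue measure on $\mathbb D$. A sequence $(\lambda_k)\subset\mathbb D$ is separated if there is $\delta>0$ with $\rho(\lambda_k,\lambda_l)\ge\delta$ for all $k\ne l$. For $\alpha\in(0,1]$ it is $\alpha$-Carleson if there is $C>0$ such that $$\sum_{k:\,\lambda_k\in Q(I)}(1-|\lambda_k|)^\alpha\le C|I|^\alpha\qquad\text{for all arcs } I\subset\partial\mathbb D,$$ where $|I|\in(0,1]$ is the normalized length of $I$ and $Q(I)=\{re^{i\theta}\in\mathbb D: r>1-|I|,\ e^{i\theta}\in I\}$. The Poisson process with intensity $\mu$ (a Borel measure on $\mathbb D$) is a random finite or infinite sequence $\Lambda$ in $\mathbb D$ such that for every Borel set $A\subset\mathbb D$ the number $N_A$ of points of $\Lambda$ in $A$ is a Poisson random variable of parameter $\mu(A)$ (with $N_A=\infty$ almost surely if $\mu(A)=\infty$), and such that the variables $N_{A_1},\dots,N_{A_n}$ are independent whenever $A_1,\dots,A_n\subset\mathbb D$ are pairwise disjoint Borel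 sets. For $a,b\in\mathbb R$ define on $\mathbb D$ the measures $$d\sigma(a,b)(z)=\frac{dm(z)}{|1-z|^a\log^b\!\left(\frac e{|1-z|}\right)},\qquad d\tau(a,b)(z)=\chi_{\Gamma}(z)\,\frac{dm(z)}{(1-|z|^2)^a\log^b\!\left(\frac e{1-|z|^2}\right)},$$ where $\Gamma=\{z\in\mathbb D:\ |1-z|<2(1-|z|)\}$. Proposition. Let either $a>2$ and $b\in\mathbb R$, or $a=2$ and $b\le 1$, and let $\Lambda$ be the Poisson process with intensity $\mu$, where $\mu=\sigma(a,b)$ or $\mu=\tau(a,b)$. (a) If $a>2$, then almost surely $\Lambda$ is not a finite union of separated sequences, and is not $\alpha$-Carleson for any $\alpha\in(0,1]$. (b) If $a=2$, then: (i) for every integer $M\ge1$, $\Lambda$ is almost surely the union of $M$ separated sequences if and only if $b>\frac1{M+1}$; moreover, if $b\le\frac1{M+1}$, then almost surely $\Lambda$ is not the union of $M$ separated sequences; (ii) for every $\alpha\in(0,1)$, if $b>1-\alpha$, then $\Lambda$ is almost surely $\alpha$-Carleson. -/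

import Mathlib

open MeasureTheory ProbabilityTheory

noncomputable section

namespace PoissonDisc

/-- The open unit disc `𝔻 ⊂ ℂ`. -/
def disc : Set ℂ := Metric.ball 0 1

/-- The pseudo-hyperbolic distance `ρ(z,w) = |(z - w) / (1 - w̄ z)|`. -/
def pseudoDist (z w : ℂ) : ℝ := ‖(z - w) / (1 - (starRingEnd ℂ) w * z)‖

/-- A finite or infinite sequence of points of the unit disc, repetitions allowed:
the terms are the `pt k` with `k ∈ index`. -/
structure DiscSequence where
  index : Set ℕ
  pt : ℕ → ℂ
  pt_mem : ∀ k ∈ index, pt k ∈ disc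

/-- `N_A`, the number of terms (with multiplicity) of the sequence that lie in `A`. -/
def DiscSequence.count (L : DiscSequence) (A : Set ℂ) : ℕ∞ :=
  {k : ℕ | k ∈ L.index ∧ L.pt k ∈ A}.encard

/-- The subsequence of `L` with index set `J` is separated: for some `δ > 0`,
`ρ(λ_k, λ_l) ≥ δ` for all distinct indices `k, l ∈ J`. -/
def DiscSequence.SeparatedOn (L : DiscSequence) (J : Set ℕ) : Prop :=
  ∃ δ : ℝ, 0 < δ ∧ ∀ k ∈ J, ∀ l ∈ J, k ≠ l → δ ≤ pseudoDist (L.pt k) (L.pt l)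

/-- `L` can be expressed as the union of `M` separated sequences. -/
def DiscSequence.IsUnionOfSeparated (L : DiscSequence) (M : ℕ) : Prop :=
  ∃ J : Fin M → Set ℕ, L.index = ⋃ i, J i ∧ ∀ i, L.SeparatedOn (J i)

/-- The Carleson window `Q(I) = {r e^{iθ} ∈ 𝔻 : r > 1 - |I|, e^{iθ} ∈ I}` of the closed arc
`I = {e^{iθ} : s ≤ θ ≤ s + 2πℓ}` of normalized length `|I| = ℓ`. -/
def carlesonWindow (s ℓ : ℝ) : Set ℂ :=
  {z : ℂ | ∃ r θ : ℝ, 1 - ℓ < r ∧ r < 1 ∧ s ≤ θ ∧ θ ≤ s + 2 * Real.pi * ℓ ∧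
    z = (r : ℂ) * Complex.exp ((θ : ℂ) * Complex.I)}

/-- The `α`-Carleson condition: for some `C > 0`, every arc `I` satisfies
`∑_{λ ∈ Q(I)} (1 - |λ|)^α ≤ C |I|^α`. (An arc without one or both of its end points has the
same length as its closure and a smaller window, so closed arcs suffice; `ℓ = 1` is the circle.) -/
def DiscSequence.IsCarleson (L : DiscSequence) (α : ℝ) : Prop :=
  ∃ C : ℝ, 0 < C ∧ ∀ s ℓ : ℝ, 0 < ℓ → ℓ ≤ 1 →
    ∑' k : {k : ℕ | k ∈ L.index ∧ L.pt k ∈ carlesonWindow s ℓ},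
        ENNReal.ofReal ((1 - ‖L.pt k‖) ^ α)
      ≤ ENNReal.ofReal (C * ℓ ^ α)

/-- The random sequence `Λ` is a Poisson point process in the disc with intensity `μ`:
the counting variables `N_A` (`A ⊆ 𝔻` Borel) are random variables with the Poisson law of
parameter `μ(A)` (where `N_A = ∞` almost surely if `μ(A) = ∞`), and the counting variables of
pairwise disjoint Borel sets are independent. -/
structure IsPoissonProcess {Ω : Type*} [MeasurableSpace Ω] (P : Measure Ω) (μ : Measure ℂ)
    (Λ : Ω → DiscSequence) : Prop where
  measurable_count : ∀ A : Set ℂ, MeasurableSet A → A ⊆ disc →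
    Measurable (fun ω => (Λ ω).count A)
  law_of_finite : ∀ A : Set ℂ, MeasurableSet A → A ⊆ disc → μ A ≠ ⊤ → ∀ k : ℕ,
    P {ω | (Λ ω).count A = k} =
      ENNReal.ofReal (Real.exp (-(μ A).toReal) * (μ A).toReal ^ k / (k.factorial : ℝ))
  law_of_infinite : ∀ A : Set ℂ, MeasurableSet A → A ⊆ disc → μ A = ⊤ →
    ∀ᵐ ω ∂P, (Λ ω).count A = ⊤
  independent : ∀ A : ℕ → Set ℂ, (∀ i, MeasurableSet (A i)) → (∀ i, A i ⊆ disc) →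
    (∀ i j, i ≠ j → Disjoint (A i) (A j)) →
    iIndepFun (fun (i : ℕ) (ω : Ω) => (Λ ω).count (A i)) P

/-- Lebesgue measure on the unit disc, normalized to have total mass `1`. -/
def normalizedArea : Measure ℂ :=
  ENNReal.ofReal (1 / Real.pi) • (volume : Measure ℂ).restrict disc

/-- `dσ(a,b) = dm / (|1 - z|^a log^b (e / |1 - z|))` on the disc. -/
def sigmaMeasure (a b : ℝ) : Measure ℂ :=
  normalizedArea.withDensity fun z =>
    ENNReal.ofReal (1 / (‖1 - z‖ ^ a * Real.log (Real.exp 1 / ‖1 - z‖) ^ b))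

/-- `dμ(a,b) = dm / ((1 - |z|²)^a log^b (e / (1 - |z|²)))` on the disc. -/
def radialMeasure (a b : ℝ) : Measure ℂ :=
  normalizedArea.withDensity fun z =>
    ENNReal.ofReal (1 / ((1 - ‖z‖ ^ 2) ^ a * Real.log (Real.exp 1 / (1 - ‖z‖ ^ 2)) ^ b))

/-- The Stolz region `Γ(ζ) = {z ∈ 𝔻 : |ζ - z| / (1 - |z|) < 2}`. -/
def stolzRegion (ζ : ℂ) : Set ℂ := {z : ℂ | z ∈ disc ∧ ‖ζ - z‖ / (1 - ‖z‖) < 2}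

/-- `dτ(a,b) = χ_{Γ(1)} dμ(a,b)`. -/
def tauMeasure (a b : ℝ) : Measure ℂ := (radialMeasure a b).restrict (stolzRegion 1)

end PoissonDisc

end

namespace PoissonDisc

open Set Filter Topology

open scoped ENNReal Nat

/-! Everything is decided near the point `1`. For `a = 2`, at distance about `2 ^ (-m)` from `1`
both densities are at most of order `4 ^ m * (m + 1) ^ (-b)` when `b ≥ 0`, while the area there is
of order `4 ^ (-m)`. A disc of fixed hyperbolic size around `1 - 2 ^ (-n)` has mass at least of
order `(n + 1) ^ (-max b 0)`. For `a > 2` its mass stays bounded below. A Poisson count reaches `K`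
with probability at most `μ(A) ^ K`, and at least a constant times this power for masses up to `1`.

Clusters: if `b * (M + 1) ≤ 1`, the second Borel–Cantelli lemma applied to disjoint, hence
independent, discs yields `M + 1` points in one disc of arbitrarily small hyperbolic size. By
pigeonhole `M` separated sequences cannot share them (`ae_not_isUnionOfSeparated`). For `a > 2` the
same argument gives any number of points in a disc of fixed hyperbolic size, which also contradicts
every Carleson condition.

Separation: if `b * (M + 1) > 1`, a union bound over cells of size `2 ^ (-(m + j + k))` shows that
the probability of some cell holding more than `M` points is `O(4 ^ (-k))`. So almost surely some
resolution `k` has no such cell, and greedy colouring splits the sequence (`ae_isUnionOfSeparated`).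

Carleson: only `b > 0` matters. The dyadic annuli about `1` then have almost surely bounded counts,
and this implies the condition for every `α > 0`. -/

/-! ### Poisson tails and Borel–Cantelli arguments -/

theorem exp_sub_sum_range_le {t : ℝ} (ht : 0 ≤ t) (K : ℕ) :
    Real.exp t - ∑ k ∈ Finset.range K, t ^ k / (k.factorial : ℝ) ≤ t ^ K * Real.exp t := by
  have h := Complex.norm_exp_sub_sum_le_norm_mul_exp (t : ℂ) K
  have e : Complex.exp (t : ℂ) - ∑ m ∈ Finset.range K, (t : ℂ) ^ m / (m.factorial : ℂ)
      = ((Real.exp t - ∑ k ∈ Finset.range K, t ^ k / (k.factorial : ℝ) : ℝ) : ℂ) := by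
    push_cast; rfl
  rw [e, Complex.norm_real, Complex.norm_real, Real.norm_of_nonneg ht] at h
  exact (le_abs_self _).trans h

theorem sum_range_le_of_one_le {t : ℝ} (ht : 1 ≤ t) (K : ℕ) :
    ∑ k ∈ Finset.range K, t ^ k / (k.factorial : ℝ) ≤ Real.exp 1 * t ^ K := by
  calc ∑ k ∈ Finset.range K, t ^ k / (k.factorial : ℝ)
      ≤ ∑ k ∈ Finset.range K, (1 : ℝ) ^ k / (k.factorial : ℝ) * t ^ K := by
        refine Finset.sum_le_sum fun k hk => ?_
        have : t ^ k ≤ t ^ K := pow_le_pow_right₀ ht (Finset.mem_range.1 hk).le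
        rw [one_pow, div_mul_eq_mul_div, one_mul]
        gcongr
    _ ≤ Real.exp 1 * t ^ K := by
        rw [← Finset.sum_mul]
        gcongr
        exact Real.sum_le_exp_of_nonneg zero_le_one K

section

variable {Ω : Type*} [MeasurableSpace Ω] {P : Measure Ω} {μ : Measure ℂ}
  {Λ : Ω → DiscSequence}

theorem IsPoissonProcess.measurableSet_count_ge (hΛ : IsPoissonProcess P μ Λ) {A : Set ℂ}
    (hA : MeasurableSet A) (hAd : A ⊆ disc) (K : ℕ) :
    MeasurableSet {ω | (K : ℕ∞) ≤ (Λ ω).count A} :=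
  hΛ.measurable_count A hA hAd (MeasurableSet.of_discrete (s := Ici (K : ℕ∞)))

theorem IsPoissonProcess.prob_count_ge [IsProbabilityMeasure P] (hΛ : IsPoissonProcess P μ Λ)
    {A : Set ℂ} (hA : MeasurableSet A) (hAd : A ⊆ disc) (hfin : μ A ≠ ⊤) (K : ℕ) :
    P {ω | (K : ℕ∞) ≤ (Λ ω).count A} = ENNReal.ofReal
      (1 - Real.exp (-(μ A).toReal) *
        ∑ k ∈ Finset.range K, (μ A).toReal ^ k / (k.factorial : ℝ)) := by
  set t := (μ A).toReal
  have ht : 0 ≤ t := ENNReal.toReal_nonneg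
  have hc : {ω | (K : ℕ∞) ≤ (Λ ω).count A}
      = (⋃ k ∈ Finset.range K, {ω | (Λ ω).count A = k})ᶜ := by
    ext ω
    simp only [mem_ofPred_eq, mem_compl_iff, mem_iUnion, Finset.mem_range, not_exists]
    constructor
    · intro h k hk he
      rw [he] at h
      exact absurd (by exact_mod_cast h) (not_le.2 hk)
    · intro h
      by_contra hlt
      rw [not_le] at hlt
      obtain ⟨k, hk⟩ := ENat.ne_top_iff_exists.1 (ne_top_of_lt hlt)
      rw [← hk] at hlt
      exact h k (by exact_mod_cast hlt) hk.symm
  have hm : ∀ k : ℕ, MeasurableSet {ω | (Λ ω).count A = k} := fun k =>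
    hΛ.measurable_count A hA hAd (MeasurableSet.of_discrete (s := {(k : ℕ∞)}))
  rw [hc, prob_compl_eq_one_sub (Finset.measurableSet_biUnion _ fun k _ => hm k),
    measure_biUnion_finset _ fun k _ => hm k,
    Finset.sum_congr rfl fun k _ => hΛ.law_of_finite A hA hAd hfin k,
    ← ENNReal.ofReal_sum_of_nonneg fun k _ => by positivity, ← ENNReal.ofReal_one,
    ← ENNReal.ofReal_sub _ (Finset.sum_nonneg fun k _ => by positivity), Finset.mul_sum]
  · simp only [mul_div_assoc]
    rfl
  · intro i _ j _ hij
    refine Set.disjoint_left.2 fun ω hi hj => hij ?_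
    have : (i : ℕ∞) = j := hi.symm.trans hj
    exact_mod_cast this

theorem IsPoissonProcess.prob_count_ge_le [IsProbabilityMeasure P]
    (hΛ : IsPoissonProcess P μ Λ) {A : Set ℂ} (hA : MeasurableSet A) (hAd : A ⊆ disc) {K : ℕ}
    (hK : K ≠ 0) : P {ω | (K : ℕ∞) ≤ (Λ ω).count A} ≤ μ A ^ K := by
  by_cases hfin : μ A = ⊤
  · rw [hfin, ENNReal.top_pow hK]
    exact le_top
  · rw [hΛ.prob_count_ge hA hAd hfin, ← ENNReal.ofReal_toReal hfin,
      ENNReal.toReal_ofReal ENNReal.toReal_nonneg, ← ENNReal.ofReal_pow ENNReal.toReal_nonneg]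
    refine ENNReal.ofReal_le_ofReal ?_
    set t := (μ A).toReal
    have h := exp_sub_sum_range_le (t := t) ENNReal.toReal_nonneg K
    have he : Real.exp (-t) * Real.exp t = 1 := by rw [← Real.exp_add]; simp
    have := mul_le_mul_of_nonneg_left h (Real.exp_pos (-t)).le
    rw [mul_sub, he] at this
    calc _ ≤ _ := this
      _ = t ^ K * (Real.exp (-t) * Real.exp t) := by ring
      _ = t ^ K := by rw [he, mul_one]

/-- For mass `t ≤ 1` the single term `P(N = K)` suffices. For `t ≥ 1` the first `K` terms of the
exponential series are at most `e * K!` times the next one, so they take up a proportion of `e ^ t`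
bounded away from `1`. The constant `1 / (1 + e * K!)` serves both cases. -/
theorem IsPoissonProcess.le_prob_count_ge [IsProbabilityMeasure P]
    (hΛ : IsPoissonProcess P μ Λ) {A : Set ℂ} (hA : MeasurableSet A) (hAd : A ⊆ disc) (K : ℕ)
    {s : ℝ} (hs0 : 0 ≤ s) (hs1 : s ≤ 1) (hs : ENNReal.ofReal s ≤ μ A) :
    ENNReal.ofReal (1 / (1 + Real.exp 1 * K.factorial) * s ^ K)
      ≤ P {ω | (K : ℕ∞) ≤ (Λ ω).count A} := by
  have hc1 : 1 / (1 + Real.exp 1 * (K.factorial : ℝ)) ≤ 1 := by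
    rw [div_le_one (by positivity)]
    have : 0 ≤ Real.exp 1 * (K.factorial : ℝ) := by positivity
    linarith
  have hsK : s ^ K ≤ 1 := pow_le_one₀ hs0 hs1
  by_cases hfin : μ A = ⊤
  · have : ∀ᵐ ω ∂P, (K : ℕ∞) ≤ (Λ ω).count A := by
      filter_upwards [hΛ.law_of_infinite A hA hAd hfin] with ω hω
      rw [hω]; exact le_top
    rw [(mem_ae_iff_prob_eq_one (hΛ.measurableSet_count_ge hA hAd K)).1 this]
    exact ENNReal.ofReal_le_one.2 (mul_le_one₀ hc1 (by positivity) hsK)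
  set t := (μ A).toReal with ht
  have hst : s ≤ t := (ENNReal.ofReal_le_iff_le_toReal hfin).1 hs
  have hf : (0 : ℝ) < K.factorial := by positivity
  rcases le_total t 1 with ht1 | ht1
  · calc ENNReal.ofReal (1 / (1 + Real.exp 1 * K.factorial) * s ^ K)
        ≤ ENNReal.ofReal (Real.exp (-t) * t ^ K / (K.factorial : ℝ)) := by
          refine ENNReal.ofReal_le_ofReal ?_
          have h1 : 1 / (1 + Real.exp 1 * (K.factorial : ℝ))
              ≤ Real.exp (-1) / (K.factorial : ℝ) := by
            rw [Real.exp_neg, div_le_div_iff₀ (by positivity) hf]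
            have : (Real.exp 1)⁻¹ * (1 + Real.exp 1 * (K.factorial : ℝ))
              = (Real.exp 1)⁻¹ + K.factorial := by field_simp
            rw [this]
            have : 0 < (Real.exp 1)⁻¹ := by positivity
            linarith
          calc _ ≤ Real.exp (-1) / (K.factorial : ℝ) * t ^ K := by gcongr
            _ ≤ Real.exp (-t) / (K.factorial : ℝ) * t ^ K := by
              have : 0 ≤ t := hs0.trans hst
              gcongr
            _ = _ := by ring
      _ = P {ω | (Λ ω).count A = K} := (hΛ.law_of_finite A hA hAd hfin K).symm
      _ ≤ _ := measure_mono fun ω (hω : _ = _) => hω.ge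
  · rw [hΛ.prob_count_ge hA hAd hfin]
    refine ENNReal.ofReal_le_ofReal ?_
    have hS := sum_range_le_of_one_le ht1 K
    have hT := Real.sum_le_exp_of_nonneg (zero_le_one.trans ht1) (K + 1)
    rw [Finset.sum_range_succ] at hT
    rw [← ht, Real.exp_neg]
    set S := ∑ k ∈ Finset.range K, t ^ k / (k.factorial : ℝ)
    set F := (K.factorial : ℝ)
    have hE : 0 < Real.exp t := Real.exp_pos t
    have he1 : 0 < Real.exp 1 := Real.exp_pos 1
    have hSE : S * (1 + Real.exp 1 * F) ≤ Real.exp 1 * F * Real.exp t := by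
      have h1 : Real.exp 1 * F * (S + t ^ K / F) ≤ Real.exp 1 * F * Real.exp t := by gcongr
      have h2 : Real.exp 1 * F * (t ^ K / F) = Real.exp 1 * t ^ K := by field_simp
      linarith [mul_add (Real.exp 1 * F) S (t ^ K / F)]
    have hkey : (Real.exp t)⁻¹ * S ≤ Real.exp 1 * F / (1 + Real.exp 1 * F) := by
      rw [inv_mul_eq_div, div_le_div_iff₀ hE (by positivity)]
      exact hSE
    have hsum : Real.exp 1 * F / (1 + Real.exp 1 * F) = 1 - 1 / (1 + Real.exp 1 * F) := by
      field_simp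
      ring
    have : 1 / (1 + Real.exp 1 * F) * s ^ K ≤ 1 / (1 + Real.exp 1 * F) :=
      mul_le_of_le_one_right (by positivity) hsK
    linarith

/-- Borel–Cantelli: disjoint sets whose masses dominate `c (n + 1) ^ (-β)`, with `β K ≤ 1`,
almost surely contain `K` points for some index. -/
theorem IsPoissonProcess.ae_exists_count_ge [IsProbabilityMeasure P]
    (hΛ : IsPoissonProcess P μ Λ) {A : ℕ → Set ℂ} (hA : ∀ n, MeasurableSet (A n))
    (hAd : ∀ n, A n ⊆ disc) (hdisj : ∀ i j, i ≠ j → Disjoint (A i) (A j)) {K : ℕ} {c β : ℝ}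
    (hc0 : 0 < c) (hβ : 0 ≤ β) (hβK : β * K ≤ 1)
    (hlow : ∀ n : ℕ, ENNReal.ofReal (c * ((n : ℝ) + 1) ^ (-β)) ≤ μ (A n)) :
    ∀ᵐ ω ∂P, ∃ n, (K : ℕ∞) ≤ (Λ ω).count (A n) := by
  -- Truncation at `1` keeps `d * (n + 1) ^ (-β)` in `[0, 1]`, as the lower tail bound requires.
  set d := min c 1
  have hd0 : 0 < d := lt_min hc0 one_pos
  set C := 1 / (1 + Real.exp 1 * (K.factorial : ℝ)) * d ^ K
  have hC : 0 < C := by positivity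
  have hprob : ∀ n : ℕ, ENNReal.ofReal (C * (1 / ((n : ℝ) + 1)))
      ≤ P {ω | (K : ℕ∞) ≤ (Λ ω).count (A n)} := by
    intro n
    have hn : (1 : ℝ) ≤ (n : ℝ) + 1 := by simp
    have h1 : ((n : ℝ) + 1) ^ (-β) ≤ 1 := Real.rpow_le_one_of_one_le_of_nonpos hn (by linarith)
    have h0 : 0 < ((n : ℝ) + 1) ^ (-β) := by positivity
    refine le_trans (ENNReal.ofReal_le_ofReal ?_) (hΛ.le_prob_count_ge (hA n) (hAd n) K
      (s := d * ((n : ℝ) + 1) ^ (-β)) (by positivity) (mul_le_one₀ (min_le_right _ _) h0.le h1)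
      ((ENNReal.ofReal_le_ofReal (by gcongr; exact min_le_left _ _)).trans (hlow n)))
    rw [mul_pow, ← mul_assoc, ← Real.rpow_natCast (_ ^ (-β)), ← Real.rpow_mul (by positivity)]
    refine mul_le_mul_of_nonneg_left ?_ hC.le
    rw [one_div, ← Real.rpow_neg_one]
    exact Real.rpow_le_rpow_of_exponent_le hn (by linarith)
  have hsum : ∑' n, P {ω | (K : ℕ∞) ≤ (Λ ω).count (A n)} = ∞ := by
    refine top_le_iff.1 (le_trans (le_of_eq ?_) (ENNReal.tsum_le_tsum hprob))
    by_contra hne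
    have hs := ENNReal.summable_toReal (Ne.symm hne)
    refine Real.not_summable_one_div_natCast ((summable_nat_add_iff 1).1 ?_)
    refine (hs.mul_left C⁻¹).congr fun n => ?_
    rw [ENNReal.toReal_ofReal (by positivity)]
    push_cast
    field_simp
  have hind : iIndepSet (fun n => {ω | (K : ℕ∞) ≤ (Λ ω).count (A n)}) P := by
    rw [iIndepSet_iff_meas_biInter fun n => hΛ.measurableSet_count_ge (hA n) (hAd n) K]
    intro S
    exact (iIndepFun_iff_measure_inter_preimage_eq_mul.1 (hΛ.independent A hA hAd hdisj)) S
      (sets := fun _ => Ici (K : ℕ∞)) fun _ _ => MeasurableSet.of_discrete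
  have h1 := measure_limsup_eq_one (fun n => hΛ.measurableSet_count_ge (hA n) (hAd n) K) hind hsum
  have h2 := (mem_ae_iff_prob_eq_one (MeasurableSet.measurableSet_limsup fun n =>
    hΛ.measurableSet_count_ge (hA n) (hAd n) K)).2 h1
  filter_upwards [h2] with ω hω
  rw [mem_limsup_iff_frequently_mem] at hω
  exact hω.exists

/-- The Poisson weights sum to `1`, so the tails `P(N ≥ K)` tend to `0`. -/
theorem IsPoissonProcess.ae_count_ne_top [IsProbabilityMeasure P]
    (hΛ : IsPoissonProcess P μ Λ) {A : Set ℂ} (hA : MeasurableSet A) (hAd : A ⊆ disc)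
    (hfin : μ A ≠ ⊤) : ∀ᵐ ω ∂P, (Λ ω).count A ≠ ⊤ := by
  set t := (μ A).toReal with ht
  have hlim : Tendsto (fun K : ℕ => ENNReal.ofReal (1 - Real.exp (-t) *
      ∑ k ∈ Finset.range K, t ^ k / (k.factorial : ℝ))) atTop (𝓝 0) := by
    have h1 := (NormedSpace.expSeries_div_hasSum_exp t).tendsto_sum_nat
    rw [← Real.exp_eq_exp_ℝ] at h1
    have h2 := ENNReal.tendsto_ofReal ((h1.const_mul (Real.exp (-t))).const_sub 1)
    rwa [← Real.exp_add, neg_add_cancel, Real.exp_zero, sub_self, ENNReal.ofReal_zero] at h2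
  rw [ae_iff]
  refine le_antisymm (ge_of_tendsto' hlim fun K => ?_) zero_le
  rw [ht, ← hΛ.prob_count_ge hA hAd hfin K]
  refine measure_mono fun ω hω => ?_
  have : (Λ ω).count A = ⊤ := by simpa using hω
  simp [this]

/-- Borel–Cantelli: the counts of sets whose masses are `O((n + 1) ^ (-b))` with `b > 0` are almost
surely bounded. -/
theorem IsPoissonProcess.ae_exists_forall_count_le [IsProbabilityMeasure P]
    (hΛ : IsPoissonProcess P μ Λ) {X : ℕ → Set ℂ} (hX : ∀ n, MeasurableSet (X n))
    (hXd : ∀ n, X n ⊆ disc) {C b : ℝ} (hC : 0 ≤ C) (hb : 0 < b)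
    (hup : ∀ n : ℕ, μ (X n) ≤ ENNReal.ofReal (C * ((n : ℝ) + 1) ^ (-b))) :
    ∀ᵐ ω ∂P, ∃ K : ℕ, ∀ n, (Λ ω).count (X n) ≤ K := by
  obtain ⟨K, hK⟩ := exists_nat_gt (1 / b)
  have hbK : 1 < b * K := by rwa [div_lt_iff₀' hb] at hK
  have hK0 : K ≠ 0 := by rintro rfl; norm_num at hbK
  have hsum : ∑' n, P {ω | (K : ℕ∞) ≤ (Λ ω).count (X n)} ≠ ∞ := by
    have hs : Summable fun n : ℕ => (C * ((n : ℝ) + 1) ^ (-b)) ^ K := by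
      have h1 := ((summable_nat_add_iff 1).2 (Real.summable_nat_rpow (p := -b * K)|>.2
        (by linarith))).mul_left (C ^ K)
      refine h1.congr fun n => ?_
      rw [mul_pow, ← Real.rpow_natCast (_ ^ (-b)), ← Real.rpow_mul (by positivity)]
      push_cast
      rfl
    refine ne_top_of_le_ne_top hs.tsum_ofReal_ne_top (ENNReal.tsum_le_tsum fun n => ?_)
    rw [ENNReal.ofReal_pow (by positivity)]
    exact (hΛ.prob_count_ge_le (hX n) (hXd n) hK0).trans (by gcongr; exact hup n)
  have hfin : ∀ᵐ ω ∂P, ∀ n, (Λ ω).count (X n) ≠ ⊤ := ae_all_iff.2 fun n =>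
    hΛ.ae_count_ne_top (hX n) (hXd n) (ne_top_of_le_ne_top ENNReal.ofReal_ne_top (hup n))
  filter_upwards [hfin, ae_eventually_notMem hsum] with ω h1 h2
  obtain ⟨N, hN⟩ := eventually_atTop.1 h2
  choose g hg using fun n => ENat.ne_top_iff_exists.1 (h1 n)
  -- The finitely many exceptional indices have finite counts, which the sum absorbs.
  refine ⟨K + ∑ i ∈ Finset.range N, g i, fun n => ?_⟩
  rcases lt_or_ge n N with hn | hn
  · rw [← hg n]
    have := Finset.single_le_sum (f := g) (fun _ _ => Nat.zero_le _) (Finset.mem_range.2 hn)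
    exact_mod_cast this.trans (Nat.le_add_left _ _)
  · have := hN n hn
    simp only [not_le] at this
    exact this.le.trans (by exact_mod_cast Nat.le_add_right _ _)

end

/-! ### Separation, colouring and pseudo-hyperbolic geometry -/

/-- Greedy colouring of a graph on `ℕ` in which every vertex has fewer than `M` earlier
neighbours. -/
theorem exists_greedy_coloring {M : ℕ} (R : ℕ → ℕ → Prop)
    (hR : ∀ k, {l | l < k ∧ R l k}.encard < M) :
    ∃ f : ℕ → Fin M, ∀ k l, l < k → R l k → f l ≠ f k := by
  have step : ∀ (k : ℕ) (g : ∀ l, l < k → Fin M), ∃ c, ∀ l (hl : l < k), R l k → g l hl ≠ c := by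
    intro k g
    -- If every colour were blocked, picking a blocking neighbour for each would inject `Fin M` into
    -- a set of fewer than `M` elements.
    by_contra! hcon
    choose s hs hsR hsc using hcon
    have hinj : Function.Injective s := by
      intro c d hcd
      rw [← hsc c, ← hsc d]
      congr 1
    have : (univ : Set (Fin M)).encard ≤ {l | l < k ∧ R l k}.encard :=
      encard_le_encard_of_injOn (f := s) (fun c _ => ⟨hs c, hsR c⟩) hinj.injOn
    rw [encard_univ, ENat.card_eq_coe_fintype_card, Fintype.card_fin] at this
    exact absurd (hR k) (not_lt.2 this)
  choose c hc using step
  refine ⟨WellFounded.fix (C := fun _ => Fin M) Nat.lt_wfRel.wf c, fun k l hl hkl => ?_⟩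
  conv_rhs => rw [WellFounded.fix_eq]
  exact hc k (fun l _ => WellFounded.fix (C := fun _ => Fin M) Nat.lt_wfRel.wf c l) l hl hkl

theorem norm_lt_one_of_mem_disc {z : ℂ} (hz : z ∈ disc) : ‖z‖ < 1 := mem_ball_zero_iff.1 hz

theorem one_sub_norm_le (z : ℂ) : 1 - ‖z‖ ≤ ‖1 - z‖ := by
  simpa using norm_sub_norm_le 1 z

theorem norm_one_sub_conj_mul (z w : ℂ) :
    ‖1 - (starRingEnd ℂ) w * z‖ = ‖1 - (starRingEnd ℂ) z * w‖ := by
  rw [← Complex.norm_conj]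
  simp [mul_comm]

theorem pseudoDist_comm (z w : ℂ) : pseudoDist z w = pseudoDist w z := by
  rw [pseudoDist, pseudoDist, norm_div, norm_div, norm_sub_rev z w, norm_one_sub_conj_mul]

theorem pseudoDist_self (z : ℂ) : pseudoDist z z = 0 := by simp [pseudoDist]

theorem one_sub_norm_le_norm_one_sub_conj_mul {z w : ℂ} (hz : z ∈ disc) :
    1 - ‖w‖ ≤ ‖1 - (starRingEnd ℂ) w * z‖ := by
  have h1 := one_sub_norm_le ((starRingEnd ℂ) w * z)
  rw [norm_mul, Complex.norm_conj] at h1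
  have := mul_le_of_le_one_right (norm_nonneg w) (norm_lt_one_of_mem_disc hz).le
  linarith

/-- The identity `1 - w̄ z = (1 - |z|²) + conj (z - w) * z` bounds the denominator by `2 * (1 - |z|)
+ |z - w|`; since `δ ≤ 1 / 2`, the last term is absorbed on the left. -/
theorem norm_sub_le_of_pseudoDist_lt {z w : ℂ} {δ : ℝ} (hz : z ∈ disc) (hw : w ∈ disc)
    (hδ : δ ≤ 1 / 2) (h : pseudoDist z w < δ) : ‖z - w‖ ≤ 4 * δ * (1 - ‖z‖) := by
  have hz1 := norm_lt_one_of_mem_disc hz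
  have hpos : 0 < ‖1 - (starRingEnd ℂ) w * z‖ :=
    lt_of_lt_of_le (by linarith [norm_lt_one_of_mem_disc hw])
      (one_sub_norm_le_norm_one_sub_conj_mul hz)
  have hδ0 : 0 < δ := lt_of_le_of_lt (norm_nonneg _) h
  rw [pseudoDist, norm_div, div_lt_iff₀ hpos] at h
  have hd : ‖1 - (starRingEnd ℂ) w * z‖ ≤ (1 - ‖z‖ ^ 2) + ‖z - w‖ := by
    have e : 1 - (starRingEnd ℂ) w * z
        = ((1 - ‖z‖ ^ 2 : ℝ) : ℂ) + (starRingEnd ℂ) (z - w) * z := by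
      have := Complex.conj_mul' z
      push_cast
      rw [map_sub, sub_mul, this]
      ring
    rw [e]
    refine (norm_add_le _ _).trans ?_
    rw [Complex.norm_real, norm_mul, Complex.norm_conj,
      Real.norm_of_nonneg (by nlinarith [norm_nonneg z])]
    have := mul_le_of_le_one_right (norm_nonneg (z - w)) hz1.le
    linarith
  have h2 : 1 - ‖z‖ ^ 2 ≤ 2 * (1 - ‖z‖) := by nlinarith [norm_nonneg z]
  have h3 : δ * ‖1 - (starRingEnd ℂ) w * z‖ ≤ δ * (2 * (1 - ‖z‖) + ‖z - w‖) := by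
    gcongr
    linarith
  nlinarith [norm_nonneg (z - w)]

/-- Join indices whose points are closer than `δ`. The colour classes of a greedy colouring are
separated. -/
theorem DiscSequence.isUnionOfSeparated_of_encard_le {L : DiscSequence} {M : ℕ} (hM : 1 ≤ M)
    {δ : ℝ} (hδ : 0 < δ)
    (h : ∀ k ∈ L.index, {l | l ∈ L.index ∧ pseudoDist (L.pt k) (L.pt l) < δ}.encard ≤ M) :
    L.IsUnionOfSeparated M := by
  obtain ⟨f, hf⟩ := exists_greedy_coloring (M := M)
    (fun l k => l ∈ L.index ∧ k ∈ L.index ∧ pseudoDist (L.pt k) (L.pt l) < δ) (by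
      intro k
      by_cases hk : k ∈ L.index
      -- The index `k` lies in its own neighbourhood, so at most `M - 1` places remain for earlier
      -- neighbours.
      · have hnot : k ∉ {l | l < k ∧ l ∈ L.index ∧ k ∈ L.index ∧
            pseudoDist (L.pt k) (L.pt l) < δ} := fun hmem => lt_irrefl _ hmem.1
        have h1 := encard_insert_of_notMem hnot
        have h2 : (insert k {l | l < k ∧ l ∈ L.index ∧ k ∈ L.index ∧
            pseudoDist (L.pt k) (L.pt l) < δ}).encard ≤ M := by
          refine le_trans (encard_le_encard ?_) (h k hk)
          rintro l (rfl | hl)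
          · exact ⟨hk, by rwa [pseudoDist_self]⟩
          · exact ⟨hl.2.1, hl.2.2.2⟩
        rw [h1] at h2
        exact (ENat.add_one_le_iff (ne_top_of_le_ne_top (ENat.natCast_ne_top M)
          (le_self_add.trans h2))).1 h2
      · have : {l | l < k ∧ l ∈ L.index ∧ k ∈ L.index ∧
            pseudoDist (L.pt k) (L.pt l) < δ} = ∅ :=
          eq_empty_of_forall_notMem fun l hl => hk hl.2.2.1
        rw [this, encard_empty]
        exact_mod_cast hM)
  refine ⟨fun i => {k | k ∈ L.index ∧ f k = i}, ?_, fun i => ⟨δ, hδ, ?_⟩⟩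
  · ext k; simp
  · rintro k ⟨hk, hki⟩ l ⟨hl, hli⟩ hkl
    by_contra! hlt
    rcases lt_or_gt_of_ne hkl with hlt' | hlt'
    · exact hf l k hlt' ⟨hk, hl, by rwa [pseudoDist_comm]⟩ (hki.trans hli.symm)
    · exact hf k l hlt' ⟨hl, hk, hlt⟩ (hli.trans hki.symm)

/-- Pigeonhole: take `δ` below all `M` separation constants; two of the `M + 1` clustered terms lie
in the same sequence. -/
theorem DiscSequence.not_isUnionOfSeparated {L : DiscSequence} {M : ℕ}
    (h : ∀ δ : ℝ, 0 < δ → ∃ A : Set ℂ, ((M + 1 : ℕ) : ℕ∞) ≤ L.count A ∧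
      ∀ z ∈ A, ∀ w ∈ A, pseudoDist z w < δ) : ¬ L.IsUnionOfSeparated M := by
  rintro ⟨J, hJ, hsep⟩
  choose d hd0 hd using hsep
  have hev : ∀ᶠ δ in 𝓝[>] (0 : ℝ), ∀ i, δ < d i := by
    rw [eventually_all]
    exact fun i => nhdsWithin_le_nhds (Iio_mem_nhds (hd0 i))
  obtain ⟨δ, hδ, hδ0⟩ := (hev.and self_mem_nhdsWithin).exists
  obtain ⟨A, hcount, hA⟩ := h δ hδ0
  have hcol : ∀ k, k ∈ L.index → ∃ i, k ∈ J i := fun k hk => by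
    rw [hJ] at hk; exact mem_iUnion.1 hk
  have hne : ∃ k0, k0 ∈ L.index := by
    by_contra! hempty
    have : {k : ℕ | k ∈ L.index ∧ L.pt k ∈ A} = ∅ :=
      eq_empty_of_forall_notMem fun k hk => hempty k hk.1
    rw [DiscSequence.count, this, encard_empty] at hcount
    simp at hcount
  obtain ⟨k0, hk0⟩ := hne
  obtain ⟨i0, -⟩ := hcol k0 hk0
  have : Nonempty (Fin M) := ⟨i0⟩
  choose! c hc using hcol
  have hinj : InjOn c {k : ℕ | k ∈ L.index ∧ L.pt k ∈ A} := by
    intro k hk l hl hkl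
    by_contra hne
    have h1 := hd (c k) k (hc k hk.1) l (hkl ▸ hc l hl.1) hne
    have h2 := hA _ hk.2 _ hl.2
    linarith [hδ (c k)]
  have := encard_le_encard_of_injOn (t := (univ : Set (Fin M))) (fun _ _ => mem_univ _) hinj
  rw [encard_univ, ENat.card_eq_coe_fintype_card, Fintype.card_fin] at this
  have h3 := hcount.trans this
  norm_cast at h3
  omega

/-! ### Dyadic annuli and grid cells around the point `1` -/

/-- The part of the disc at distance about `2 ^ (-m)` from the point `1`. -/
def annulus (m : ℕ) : Set ℂ :=
  {z | z ∈ disc ∧ (1 / 2 : ℝ) ^ m < ‖1 - z‖ ∧ ‖1 - z‖ ≤ 2 * (1 / 2 : ℝ) ^ m}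

theorem exists_half_pow_near {x : ℝ} (h0 : 0 < x) (h2 : x ≤ 2) :
    ∃ m : ℕ, (1 / 2 : ℝ) ^ m < x ∧ x ≤ 2 * (1 / 2 : ℝ) ^ m := by
  obtain ⟨m, hm1, hm2⟩ := exists_nat_pow_near_of_lt_one (x := x / 2) (y := (1 / 2 : ℝ))
    (by linarith) (by linarith) (by norm_num) (by norm_num)
  rw [pow_succ] at hm1
  exact ⟨m, by linarith, by linarith⟩

theorem norm_one_sub_pos {z : ℂ} (hz : z ∈ disc) : 0 < ‖1 - z‖ :=
  lt_of_lt_of_le (by linarith [norm_lt_one_of_mem_disc hz]) (one_sub_norm_le z)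

theorem norm_one_sub_lt_two {z : ℂ} (hz : z ∈ disc) : ‖1 - z‖ < 2 := by
  have := norm_sub_le 1 z
  rw [norm_one] at this
  linarith [norm_lt_one_of_mem_disc hz]

theorem exists_mem_annulus {z : ℂ} (hz : z ∈ disc) : ∃ m, z ∈ annulus m := by
  obtain ⟨m, h1, h2⟩ := exists_half_pow_near (norm_one_sub_pos hz) (norm_one_sub_lt_two hz).le
  exact ⟨m, hz, h1, h2⟩

/-- A square-like cell of size `2 ^ (-(m + j + k))` at distance about `2 ^ (-m)` from `1`, centred
at the point `1 + 2 ^ (-(m + j + k)) (u + i v)` of a grid. -/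
def cell (m j k : ℕ) (u v : ℤ) : Set ℂ :=
  {w | w ∈ disc ∧ (1 / 2 : ℝ) ^ m / 2 ≤ ‖1 - w‖ ∧ ‖1 - w‖ ≤ 4 * (1 / 2 : ℝ) ^ m ∧
    w ∈ Metric.closedBall
      (1 + (((1 / 2 : ℝ) ^ (m + j + k) : ℝ) : ℂ) * ((u : ℂ) + (v : ℂ) * Complex.I))
      (2 * (1 / 2 : ℝ) ^ (m + j + k))}

/-- The indices of the grid points needed to cover the disc by cells. -/
noncomputable def gridRange (n : ℕ) : Finset ℤ := Finset.Icc (-2 ^ (n + 2)) (2 ^ (n + 2))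

theorem exists_grid_point {x h : ℝ} {n : ℕ} (hh : 0 < h) (hx : |x| ≤ 2 * 2 ^ n * h) :
    ∃ u ∈ gridRange n, |x - h * u| ≤ h / 2 := by
  have hr := abs_sub_round (x / h)
  refine ⟨round (x / h), ?_, ?_⟩
  · have h1 : |x / h| ≤ 2 * 2 ^ n := by
      rw [abs_div, abs_of_pos hh, div_le_iff₀ hh]; exact hx
    have h2 : |((round (x / h) : ℤ) : ℝ)| ≤ 2 ^ (n + 2) := by
      have h3 : (1 : ℝ) ≤ 2 ^ n := one_le_pow₀ (by norm_num)
      have h4 := abs_sub_abs_le_abs_sub ((round (x / h) : ℤ) : ℝ) (x / h)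
      rw [abs_sub_comm] at h4
      rw [pow_add]
      linarith
    rw [abs_le] at h2
    rw [gridRange, Finset.mem_Icc]
    exact ⟨by exact_mod_cast h2.1, by exact_mod_cast h2.2⟩
  · have : x - h * (round (x / h) : ℤ) = h * (x / h - (round (x / h) : ℤ)) := by field_simp
    rw [this, abs_mul, abs_of_pos hh]
    nlinarith

/-- Here `2 ^ (-m)` is the scale of `|1 - z|` and `2 ^ (-(m + j))` that of `1 - |z|`. The cell is
large enough to contain a whole pseudo-hyperbolic neighbourhood of `z`, so bounding cell counts
controls all neighbours at once. -/
theorem exists_cell {z : ℂ} (hz : z ∈ disc) {k : ℕ} (hk : 1 ≤ k) :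
    ∃ m j : ℕ, ∃ u ∈ gridRange (j + k), ∃ v ∈ gridRange (j + k), ∀ w ∈ disc,
      pseudoDist z w < (1 / 2 : ℝ) ^ (k + 3) → w ∈ cell m j k u v := by
  obtain ⟨m, -, hm1, hm2⟩ := exists_mem_annulus hz
  have hz1 := norm_lt_one_of_mem_disc hz
  obtain ⟨n, hn1, hn2⟩ := exists_half_pow_near (x := 1 - ‖z‖) (by linarith)
    (by linarith [norm_nonneg z])
  have hmn : m ≤ n := by
    by_contra! hlt
    have h1 : (1 / 2 : ℝ) ^ m ≤ (1 / 2 : ℝ) ^ (n + 1) :=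
      pow_le_pow_of_le_one (by norm_num) (by norm_num) hlt
    rw [pow_succ] at h1
    linarith [one_sub_norm_le z]
  obtain ⟨j, rfl⟩ := Nat.exists_eq_add_of_le hmn
  set h : ℝ := (1 / 2 : ℝ) ^ (m + j + k) with hh
  have hh0 : 0 < h := by positivity
  have hhm : 2 * (1 / 2 : ℝ) ^ m = 2 * 2 ^ (j + k) * h := by
    have h1 : (2 : ℝ) ^ (j + k) * (1 / 2 : ℝ) ^ (j + k) = 1 := by rw [← mul_pow]; norm_num
    rw [hh, add_assoc, pow_add (1 / 2 : ℝ) m (j + k)]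
    linear_combination (-2 * (1 / 2 : ℝ) ^ m) * h1
  have hre : |(z - 1).re| ≤ 2 * 2 ^ (j + k) * h := by
    rw [← hhm]
    exact (Complex.abs_re_le_norm _).trans (by rwa [norm_sub_rev])
  have him : |(z - 1).im| ≤ 2 * 2 ^ (j + k) * h := by
    rw [← hhm]
    exact (Complex.abs_im_le_norm _).trans (by rwa [norm_sub_rev])
  obtain ⟨u, hu, hu'⟩ := exists_grid_point hh0 hre
  obtain ⟨v, hv, hv'⟩ := exists_grid_point hh0 him
  refine ⟨m, j, u, hu, v, hv, fun w hw hzw => ?_⟩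
  have hδ : (1 / 2 : ℝ) ^ (k + 3) ≤ 1 / 2 := by
    have := pow_le_pow_of_le_one (a := (1 / 2 : ℝ)) (by norm_num) (by norm_num)
      (show 1 ≤ k + 3 by omega)
    simpa using this
  -- The exponent `k + 3` cancels the factors `4` and `2`. With the rounding error, at most `h / 2`
  -- per coordinate, this gives the cell radius `2 * h`.
  have hd : ‖z - w‖ ≤ h := by
    calc ‖z - w‖ ≤ 4 * (1 / 2 : ℝ) ^ (k + 3) * (1 - ‖z‖) :=
          norm_sub_le_of_pseudoDist_lt hz hw hδ hzw
      _ ≤ 4 * (1 / 2 : ℝ) ^ (k + 3) * (2 * (1 / 2 : ℝ) ^ (m + j)) := by gcongr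
      _ = h := by rw [hh, pow_add _ k 3, pow_add _ (m + j) k]; ring
  have hhm2 : h ≤ (1 / 2 : ℝ) ^ m / 2 := by
    have := pow_le_pow_of_le_one (a := (1 / 2 : ℝ)) (by norm_num) (by norm_num)
      (show m + 1 ≤ m + j + k by omega)
    rw [pow_succ] at this
    linarith
  have t1 : ‖1 - z‖ ≤ ‖1 - w‖ + ‖z - w‖ := by
    have : 1 - z = (1 - w) - (z - w) := by ring
    rw [this]; exact norm_sub_le _ _
  have t2 : ‖1 - w‖ ≤ ‖1 - z‖ + ‖z - w‖ := by
    have : 1 - w = (1 - z) + (z - w) := by ring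
    rw [this]; exact norm_add_le _ _
  refine ⟨hw, by linarith, by linarith [pow_pos (show (0 : ℝ) < 1 / 2 by norm_num) m], ?_⟩
  rw [Metric.mem_closedBall, dist_eq_norm]
  set p : ℂ := 1 + (h : ℂ) * ((u : ℂ) + (v : ℂ) * Complex.I) with hp
  have hzp : ‖z - p‖ ≤ h := by
    have e1 : (z - p).re = (z - 1).re - h * u := by simp [hp]; ring
    have e2 : (z - p).im = (z - 1).im - h * v := by simp [hp]
    have := Complex.norm_le_abs_re_add_abs_im (z - p)
    rw [e1, e2] at this
    linarith
  have : w - p = (z - p) - (z - w) := by ring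
  rw [this]
  linarith [norm_sub_le (z - p) (z - w)]

theorem DiscSequence.isUnionOfSeparated_of_forall_cell {L : DiscSequence} {M k : ℕ}
    (hM : 1 ≤ M) (hk : 1 ≤ k)
    (h : ∀ m j : ℕ, ∀ u ∈ gridRange (j + k), ∀ v ∈ gridRange (j + k),
      L.count (cell m j k u v) ≤ M) : L.IsUnionOfSeparated M := by
  refine L.isUnionOfSeparated_of_encard_le hM (δ := (1 / 2 : ℝ) ^ (k + 3)) (by positivity) ?_
  intro q hq
  obtain ⟨m, j, u, hu, v, hv, hcell⟩ := exists_cell (L.pt_mem q hq) hk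
  refine le_trans (encard_le_encard ?_) (h m j u hu v hv)
  exact fun l hl => ⟨hl.1, hcell _ (L.pt_mem l hl.1) hl.2⟩

/-! ### Carleson windows and bounded annular counts -/

theorem one_sub_norm_lt_of_mem_carlesonWindow {s ℓ : ℝ} {z : ℂ} (hz : z ∈ carlesonWindow s ℓ) :
    1 - ‖z‖ < ℓ := by
  obtain ⟨r, θ, hr, -, -, -, rfl⟩ := hz
  rw [norm_mul, Complex.norm_exp_ofReal_mul_I, mul_one, Complex.norm_real, Real.norm_eq_abs]
  linarith [le_abs_self r]

/-- The radial part contributes at most `ℓ`, the angular part at most `2πℓ`, and `1 + 2π < 8`. -/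
theorem norm_sub_le_of_mem_carlesonWindow {s ℓ : ℝ} (hℓ1 : ℓ ≤ 1) {z w : ℂ}
    (hz : z ∈ carlesonWindow s ℓ) (hw : w ∈ carlesonWindow s ℓ) : ‖z - w‖ ≤ 8 * ℓ := by
  obtain ⟨r, θ, hr, hr1, hs, hs', rfl⟩ := hz
  obtain ⟨r', θ', hr', hr1', ht, ht', rfl⟩ := hw
  have e : (r : ℂ) * Complex.exp (θ * Complex.I) - r' * Complex.exp (θ' * Complex.I)
      = ((r - r' : ℝ) : ℂ) * Complex.exp (θ * Complex.I)
        + r' * (Complex.exp (θ' * Complex.I)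
          * (Complex.exp (Complex.I * ((θ - θ' : ℝ) : ℂ)) - 1)) := by
    rw [mul_sub, ← Complex.exp_add]
    push_cast
    ring_nf
  have h1 : |r - r'| ≤ ℓ := abs_le.2 ⟨by linarith, by linarith⟩
  have h2 : |θ - θ'| ≤ 2 * Real.pi * ℓ := abs_le.2 ⟨by linarith, by linarith⟩
  have h3 : |r'| ≤ 1 := abs_le.2 ⟨by linarith, by linarith⟩
  have h4 := Real.norm_exp_I_mul_ofReal_sub_one_le (x := θ - θ')
  have hℓ : 0 ≤ ℓ := (abs_nonneg _).trans h1
  rw [e]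
  refine (norm_add_le _ _).trans ?_
  rw [norm_mul, norm_mul, norm_mul, Complex.norm_exp_ofReal_mul_I, Complex.norm_exp_ofReal_mul_I,
    Complex.norm_real, Complex.norm_real, one_mul, mul_one, Real.norm_eq_abs, Real.norm_eq_abs]
  have h5 : |r'| * ‖Complex.exp (Complex.I * ((θ - θ' : ℝ) : ℂ)) - 1‖ ≤ 1 * |θ - θ'| := by
    rw [Real.norm_eq_abs] at h4
    gcongr
  nlinarith [Real.pi_lt_d2]

theorem DiscSequence.tsum_le_of_forall_le {L : DiscSequence} {A : Set ℂ} {K : ℕ}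
    (hK : L.count A ≤ K) {T : Set ℕ} (hT : ∀ k ∈ T, k ∈ L.index ∧ L.pt k ∈ A) {α x : ℝ}
    (hα : 0 ≤ α) (hx : ∀ k ∈ T, 1 - ‖L.pt k‖ ≤ x) :
    ∑' k : T, ENNReal.ofReal ((1 - ‖L.pt k‖) ^ α) ≤ K * ENNReal.ofReal (x ^ α) := by
  calc ∑' k : T, ENNReal.ofReal ((1 - ‖L.pt k‖) ^ α) ≤ ∑' _ : T, ENNReal.ofReal (x ^ α) := by
        refine ENNReal.tsum_le_tsum fun k => ENNReal.ofReal_le_ofReal ?_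
        have h1 := norm_lt_one_of_mem_disc (L.pt_mem k (hT k k.2).1)
        exact Real.rpow_le_rpow (by linarith) (hx k k.2) hα
    _ = (T.encard : ℝ≥0∞) * ENNReal.ofReal (x ^ α) := ENNReal.tsum_set_const _ _
    _ ≤ K * ENNReal.ofReal (x ^ α) := by
        gcongr
        have : T.encard ≤ K := (encard_le_encard fun k hk => hT k hk).trans hK
        exact_mod_cast ENat.toENNReal_le.2 this

/-- A sequence with a bounded number of terms at each dyadic distance from `1` is `α`-Carleson. -/
theorem DiscSequence.isCarleson_of_count_annulus_le {L : DiscSequence} {K : ℕ}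
    (hK : ∀ m, L.count (annulus m) ≤ K) {α : ℝ} (hα : 0 < α) : L.IsCarleson α := by
  set q : ℝ := (1 / 2 : ℝ) ^ α with hq
  have hq0 : 0 < q := by positivity
  have hq1 : q < 1 := Real.rpow_lt_one (by norm_num) (by norm_num) hα
  have h1q : 0 < 1 - q := by linarith
  -- The terms cover a geometric tail and at most `8` outer annuli; the final `1` keeps the constant
  -- positive when `K = 0`.
  refine ⟨K * (2 ^ α * (1 - q)⁻¹ + 8) + 1, by positivity, fun s ℓ hℓ hℓ1 => ?_⟩
  set f : ℕ → ℝ≥0∞ := fun k => ENNReal.ofReal ((1 - ‖L.pt k‖) ^ α)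
  set T : ℕ → Set ℕ := fun m =>
    {k | k ∈ L.index ∧ L.pt k ∈ carlesonWindow s ℓ ∧ L.pt k ∈ annulus m}
  obtain ⟨n, hn⟩ : ∃ n : ℕ, (1 / 2 : ℝ) ^ n ≤ ℓ :=
    (exists_pow_lt_of_lt_one hℓ (by norm_num)).imp fun _ h => h.le
  classical
  set hex : ∃ n : ℕ, (1 / 2 : ℝ) ^ n ≤ ℓ := ⟨n, hn⟩
  -- Annuli with `m ≥ N` lie within about `ℓ` of `1` and contribute a geometric series. Farther out,
  -- the window has diameter at most `8 * ℓ` and meets only a few annuli.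
  set N := Nat.find hex
  have hN : (1 / 2 : ℝ) ^ N ≤ ℓ := Nat.find_spec hex
  have hlt : ∀ m < N, ℓ < (1 / 2 : ℝ) ^ m := fun m hm => not_le.1 (Nat.find_min hex hm)
  set F : Finset ℕ := (Finset.range N).filter fun m => (T m).Nonempty
  -- If `m' ≥ m + 4`, then `2 ^ (-m) < 2 * 2 ^ (-m') + 8 * ℓ < 10 * 2 ^ (-m') ≤ (10 / 16) * 2 ^
  -- (-m)`, which is absurd.
  have hnear : ∀ m ∈ F, ∀ m' ∈ F, m' < m + 4 := by
    intro m hm m' hm'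
    obtain ⟨hmN, k, hk, hkQ, -, hk1, hk2⟩ := Finset.mem_filter.1 hm
    obtain ⟨hmN', k', hk', hkQ', -, hk1', hk2'⟩ := Finset.mem_filter.1 hm'
    by_contra! hcon
    have h1 := hlt m' (Finset.mem_range.1 hmN')
    have h2 := norm_sub_le_of_mem_carlesonWindow hℓ1 hkQ' hkQ
    have h3 : ‖1 - L.pt k‖ ≤ ‖1 - L.pt k'‖ + ‖L.pt k' - L.pt k‖ := by
      have : 1 - L.pt k = (1 - L.pt k') + (L.pt k' - L.pt k) := by ring
      rw [this]; exact norm_add_le _ _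
    have h4 : (1 / 2 : ℝ) ^ m' ≤ (1 / 2 : ℝ) ^ (m + 4) :=
      pow_le_pow_of_le_one (by norm_num) (by norm_num) hcon
    rw [pow_add] at h4
    norm_num at h4 h1 h2 h3 hk1 hk2'
    linarith
  have hFcard : F.card ≤ 8 := by
    rcases F.eq_empty_or_nonempty with h | ⟨m, hm⟩
    · simp [h]
    · have : F ⊆ Finset.Icc (m - 3) (m + 3) := fun m' hm' => by
        have h1 := hnear m hm m' hm'
        have h2 := hnear m' hm' m hm
        rw [Finset.mem_Icc]
        omega
      have := Finset.card_le_card this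
      rw [Nat.card_Icc] at this
      omega
  have hcover : {k : ℕ | k ∈ L.index ∧ L.pt k ∈ carlesonWindow s ℓ}
      ⊆ (⋃ i, T (N + i)) ∪ ⋃ m ∈ F, T m := by
    rintro k ⟨hk, hkQ⟩
    obtain ⟨m, hm⟩ := exists_mem_annulus (L.pt_mem k hk)
    rcases lt_or_ge m N with h | h
    · exact Or.inr (mem_biUnion (show m ∈ F from Finset.mem_filter.2
        ⟨Finset.mem_range.2 h, k, hk, hkQ, hm⟩) ⟨hk, hkQ, hm⟩)
    · obtain ⟨i, rfl⟩ := Nat.exists_eq_add_of_le h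
      exact Or.inl (mem_iUnion.2 ⟨i, hk, hkQ, hm⟩)
  have htail : ∀ i, ∑' k : T (N + i), f k
      ≤ K * ENNReal.ofReal (2 ^ α * ℓ ^ α * q ^ i) := by
    intro i
    have e : 2 ^ α * ℓ ^ α * q ^ i = (2 * ℓ * (1 / 2 : ℝ) ^ i) ^ α := by
      rw [Real.mul_rpow (by positivity) (by positivity), Real.mul_rpow (by norm_num) hℓ.le, hq,
        ← Real.rpow_natCast, ← Real.rpow_natCast, ← Real.rpow_mul (by norm_num),
        ← Real.rpow_mul (by norm_num), mul_comm α]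
    rw [e]
    refine L.tsum_le_of_forall_le (hK (N + i)) (fun k hk => ⟨hk.1, hk.2.2⟩) hα.le ?_
    intro k hk
    calc 1 - ‖L.pt k‖ ≤ ‖1 - L.pt k‖ := one_sub_norm_le _
      _ ≤ 2 * (1 / 2 : ℝ) ^ (N + i) := hk.2.2.2.2
      _ = 2 * (1 / 2 : ℝ) ^ N * (1 / 2 : ℝ) ^ i := by rw [pow_add]; ring
      _ ≤ 2 * ℓ * (1 / 2 : ℝ) ^ i := by gcongr
  have hhead : ∀ m ∈ F, ∑' k : T m, f k ≤ K * ENNReal.ofReal (ℓ ^ α) := fun m _ =>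
    L.tsum_le_of_forall_le (hK m) (fun k hk => ⟨hk.1, hk.2.2⟩) hα.le
      fun k hk => (one_sub_norm_lt_of_mem_carlesonWindow hk.2.1).le
  calc ∑' k : {k : ℕ | k ∈ L.index ∧ L.pt k ∈ carlesonWindow s ℓ}, f k
      ≤ ∑' k : ↑((⋃ i, T (N + i)) ∪ ⋃ m ∈ F, T m), f k := ENNReal.tsum_mono_subtype f hcover
    _ ≤ ∑' k : ↑(⋃ i, T (N + i)), f k + ∑' k : ↑(⋃ m ∈ F, T m), f k :=
        ENNReal.tsum_union_le f _ _
    _ ≤ ∑' i, ∑' k : T (N + i), f k + ∑ m ∈ F, ∑' k : T m, f k :=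
        add_le_add (ENNReal.tsum_iUnion_le_tsum f _) (ENNReal.tsum_biUnion_le f _ _)
    _ ≤ ∑' i, K * ENNReal.ofReal (2 ^ α * ℓ ^ α * q ^ i)
          + ∑ m ∈ F, K * ENNReal.ofReal (ℓ ^ α) :=
        add_le_add (ENNReal.tsum_le_tsum htail) (Finset.sum_le_sum hhead)
    _ ≤ K * ENNReal.ofReal (2 ^ α * ℓ ^ α * (1 - q)⁻¹) + 8 * (K * ENNReal.ofReal (ℓ ^ α)) := by
        rw [ENNReal.tsum_mul_left, ← ENNReal.ofReal_tsum_of_nonneg (fun i => by positivity)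
          ((summable_geometric_of_lt_one hq0.le hq1).mul_left _), tsum_mul_left,
          tsum_geometric_of_lt_one hq0.le hq1, Finset.sum_const, nsmul_eq_mul]
        gcongr
        exact_mod_cast hFcard
    _ = ENNReal.ofReal (K * (2 ^ α * ℓ ^ α * (1 - q)⁻¹) + 8 * (K * ℓ ^ α)) := by
        rw [ENNReal.ofReal_add (by positivity) (by positivity),
          ENNReal.ofReal_mul (p := 8) (by positivity),
          ENNReal.ofReal_mul (p := (K : ℝ)) (by positivity),
          ENNReal.ofReal_mul (p := (K : ℝ)) (by positivity)]
        simp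
    _ ≤ ENNReal.ofReal ((K * (2 ^ α * (1 - q)⁻¹ + 8) + 1) * ℓ ^ α) := by
        refine ENNReal.ofReal_le_ofReal ?_
        have : 0 < ℓ ^ α := by positivity
        nlinarith

/-! ### Discs of fixed hyperbolic size along the radius to `1` -/

/-- The disc of centre `1 - 2 ^ (-n)` and radius `ε 2 ^ (-n)`. -/
def realBall (ε : ℝ) (n : ℕ) : Set ℂ :=
  Metric.ball ((1 - (1 / 2 : ℝ) ^ n : ℝ) : ℂ) (ε * (1 / 2 : ℝ) ^ n)

theorem norm_sub_lt_of_mem_realBall {ε : ℝ} {n : ℕ} {z : ℂ} (hz : z ∈ realBall ε n) :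
    ‖z - ((1 - (1 / 2 : ℝ) ^ n : ℝ) : ℂ)‖ < ε * (1 / 2 : ℝ) ^ n := mem_ball_iff_norm.1 hz

theorem norm_lt_of_mem_realBall {ε : ℝ} {n : ℕ} {z : ℂ} (hz : z ∈ realBall ε n) :
    (1 - ε) * (1 / 2 : ℝ) ^ n < 1 - ‖z‖ := by
  have h1 := norm_sub_lt_of_mem_realBall hz
  have h2 := norm_sub_norm_le z ((1 - (1 / 2 : ℝ) ^ n : ℝ) : ℂ)
  have h3 : (1 / 2 : ℝ) ^ n ≤ 1 := pow_le_one₀ (by norm_num) (by norm_num)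
  rw [Complex.norm_real, Real.norm_of_nonneg (by linarith)] at h2
  linarith

theorem norm_one_sub_lt_of_mem_realBall {ε : ℝ} {n : ℕ} {z : ℂ} (hz : z ∈ realBall ε n) :
    ‖1 - z‖ < (1 + ε) * (1 / 2 : ℝ) ^ n := by
  have h1 := norm_sub_lt_of_mem_realBall hz
  have e : 1 - z = (((1 / 2 : ℝ) ^ n : ℝ) : ℂ) - (z - ((1 - (1 / 2 : ℝ) ^ n : ℝ) : ℂ)) := by
    push_cast; ring
  rw [e]
  have := norm_sub_le (((1 / 2 : ℝ) ^ n : ℝ) : ℂ) (z - ((1 - (1 / 2 : ℝ) ^ n : ℝ) : ℂ))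
  rw [Complex.norm_real, Real.norm_of_nonneg (by positivity)] at this
  linarith

theorem realBall_subset_disc {ε : ℝ} (hε : ε ≤ 1 / 8) (n : ℕ) : realBall ε n ⊆ disc := by
  intro z hz
  have h1 := norm_lt_of_mem_realBall hz
  have : 0 < (1 - ε) * (1 / 2 : ℝ) ^ n := mul_pos (by linarith) (by positivity)
  exact mem_ball_zero_iff.2 (by linarith)

theorem disjoint_realBall {ε : ℝ} (hε : ε ≤ 1 / 8) {i j : ℕ} (hij : i ≠ j) :
    Disjoint (realBall ε i) (realBall ε j) := by
  wlog hlt : i < j generalizing i j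
  · exact (this hij.symm (by omega)).symm
  refine Set.disjoint_left.2 fun z hi hj => ?_
  have h1 := (norm_lt_of_mem_realBall hi).trans_le (one_sub_norm_le z)
  have h2 := norm_one_sub_lt_of_mem_realBall hj
  have h3 : (1 / 2 : ℝ) ^ j ≤ (1 / 2 : ℝ) ^ (i + 1) :=
    pow_le_pow_of_le_one (by norm_num) (by norm_num) hlt
  rw [pow_succ] at h3
  have h4 : 0 < (1 / 2 : ℝ) ^ i := by positivity
  have h5 : 0 < (1 / 2 : ℝ) ^ j := by positivity
  nlinarith

theorem pseudoDist_lt_of_mem_realBall {ε : ℝ} (hε : ε ≤ 1 / 8) {n : ℕ} {z w : ℂ}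
    (hz : z ∈ realBall ε n) (hw : w ∈ realBall ε n) : pseudoDist z w < 4 * ε := by
  have h1 := norm_sub_lt_of_mem_realBall hz
  have h2 := norm_sub_lt_of_mem_realBall hw
  have h3 := one_sub_norm_le_norm_one_sub_conj_mul (w := w) (realBall_subset_disc hε n hz)
  have h4 := norm_lt_of_mem_realBall hw
  have h5 : 0 < (1 / 2 : ℝ) ^ n := by positivity
  have hε0 : 0 < ε := pos_of_mul_pos_left ((norm_nonneg _).trans_lt h1) h5.le
  have h6 : ‖z - w‖ < 2 * ε * (1 / 2 : ℝ) ^ n := by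
    have e : z - w = (z - ((1 - (1 / 2 : ℝ) ^ n : ℝ) : ℂ))
        - (w - ((1 - (1 / 2 : ℝ) ^ n : ℝ) : ℂ)) := by ring
    rw [e]
    linarith [norm_sub_le (z - ((1 - (1 / 2 : ℝ) ^ n : ℝ) : ℂ))
      (w - ((1 - (1 / 2 : ℝ) ^ n : ℝ) : ℂ))]
  have h7 : (1 / 2 : ℝ) ^ n / 2 ≤ (1 - ε) * (1 / 2 : ℝ) ^ n := by nlinarith
  have h8 : (1 / 2 : ℝ) ^ n / 2 < ‖1 - (starRingEnd ℂ) w * z‖ := by linarith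
  rw [pseudoDist, norm_div, div_lt_iff₀ (by linarith)]
  nlinarith

theorem realBall_subset_carlesonWindow {ε : ℝ} (hε : ε ≤ 1 / 8) {n : ℕ} (hn : 1 ≤ n) :
    realBall ε n ⊆ carlesonWindow (-(Real.pi * (2 * (1 / 2 : ℝ) ^ n))) (2 * (1 / 2 : ℝ) ^ n) := by
  intro z hz
  set x : ℝ := (1 / 2 : ℝ) ^ n with hx
  have hx0 : 0 < x := by positivity
  have hx1 : x ≤ 1 / 2 := by
    have := pow_le_pow_of_le_one (a := (1 / 2 : ℝ)) (by norm_num) (by norm_num) hn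
    rwa [pow_one] at this
  have h1 := norm_sub_lt_of_mem_realBall hz
  rw [← hx] at h1
  have hre := (Complex.abs_re_le_norm _).trans_lt h1
  have him := (Complex.abs_im_le_norm _).trans_lt h1
  simp only [Complex.sub_re, Complex.ofReal_re, Complex.sub_im, Complex.ofReal_im, sub_zero]
    at hre him
  rw [abs_lt] at hre
  have hεx : ε * x ≤ x / 8 := by nlinarith
  have hzre : 1 - 9 / 8 * x < z.re := by linarith
  have hnorm : 1 - 9 / 8 * x < ‖z‖ := hzre.trans_le (Complex.re_le_norm z)
  have hz0 : 0 < ‖z‖ := by linarith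
  have hne : z ≠ 0 := norm_pos_iff.1 hz0
  have harg : |Complex.arg z| ≤ Real.pi / 2 :=
    Complex.abs_arg_le_pi_div_two_iff.2 (by linarith)
  -- Jordan's inequality turns the bound on `|Im z| / |z|` into a bound on the argument.
  have hJ := Real.mul_abs_le_abs_sin harg
  have hsin : |Real.sin (Complex.arg z)| ≤ x := by
    rw [Complex.sin_arg, abs_div, abs_norm, div_le_iff₀ hz0]
    nlinarith
  have hargx : |Complex.arg z| ≤ Real.pi * (2 * x) := by
    have hpi := Real.pi_pos
    have h2 : 2 / Real.pi * |Complex.arg z| ≤ x := hJ.trans hsin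
    rw [div_mul_eq_mul_div, div_le_iff₀ hpi] at h2
    nlinarith [abs_nonneg (Complex.arg z)]
  rw [abs_le] at hargx
  refine ⟨‖z‖, Complex.arg z, by linarith,
    norm_lt_one_of_mem_disc (realBall_subset_disc hε n hz), hargx.1, by linarith [hargx.2], ?_⟩
  exact (Complex.norm_mul_exp_arg_mul_I z).symm

/-- With `x = 2 ^ (-n)`, each of the `K` points contributes at least `(x / 2) ^ α` to a window of
length `2 * x`, which forces `K ≤ C * 4 ^ α`. -/
theorem DiscSequence.not_isCarleson {L : DiscSequence} {ε : ℝ} (hε : ε ≤ 1 / 8)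
    (h : ∀ K : ℕ, ∃ n, 1 ≤ n ∧ (K : ℕ∞) ≤ L.count (realBall ε n)) {α : ℝ} (hα : 0 < α) :
    ¬ L.IsCarleson α := by
  rintro ⟨C, hC, hcar⟩
  obtain ⟨K, hK⟩ := exists_nat_gt (C * 4 ^ α)
  obtain ⟨n, hn, hcount⟩ := h K
  set x : ℝ := (1 / 2 : ℝ) ^ n with hx
  have hx0 : 0 < x := by positivity
  have hx1 : x ≤ 1 / 2 := by
    have := pow_le_pow_of_le_one (a := (1 / 2 : ℝ)) (by norm_num) (by norm_num) hn
    rwa [pow_one] at this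
  have h1 := hcar (-(Real.pi * (2 * x))) (2 * x) (by positivity) (by linarith)
  have h2 : (K : ℝ≥0∞) * ENNReal.ofReal ((x / 2) ^ α) ≤ ENNReal.ofReal (C * (2 * x) ^ α) := by
    refine le_trans ?_ h1
    calc (K : ℝ≥0∞) * ENNReal.ofReal ((x / 2) ^ α)
        ≤ (({k | k ∈ L.index ∧ L.pt k ∈ realBall ε n} : Set ℕ).encard : ℝ≥0∞)
            * ENNReal.ofReal ((x / 2) ^ α) := by
          gcongr
          exact_mod_cast ENat.toENNReal_le.2 hcount
      _ = ∑' _ : {k | k ∈ L.index ∧ L.pt k ∈ realBall ε n}, ENNReal.ofReal ((x / 2) ^ α) :=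
          (ENNReal.tsum_set_const _ _).symm
      _ ≤ ∑' k : {k | k ∈ L.index ∧ L.pt k ∈ realBall ε n},
            ENNReal.ofReal ((1 - ‖L.pt k‖) ^ α) := by
          refine ENNReal.tsum_le_tsum fun k => ENNReal.ofReal_le_ofReal ?_
          have := norm_lt_of_mem_realBall k.2.2
          rw [← hx] at this
          exact Real.rpow_le_rpow (by positivity) (by nlinarith) hα.le
      _ ≤ ∑' k : {k | k ∈ L.index ∧
              L.pt k ∈ carlesonWindow (-(Real.pi * (2 * x))) (2 * x)},
            ENNReal.ofReal ((1 - ‖L.pt k‖) ^ α) := by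
          refine ENNReal.tsum_mono_subtype (fun k => ENNReal.ofReal ((1 - ‖L.pt k‖) ^ α)) ?_
          exact fun k hk => ⟨hk.1, realBall_subset_carlesonWindow hε hn hk.2⟩
  rw [← ENNReal.ofReal_natCast, ← ENNReal.ofReal_mul (by positivity),
    ENNReal.ofReal_le_ofReal_iff (by positivity)] at h2
  have e : (2 * x) ^ α = 4 ^ α * (x / 2) ^ α := by
    rw [← Real.mul_rpow (by norm_num) (by positivity)]
    ring_nf
  rw [e, ← mul_assoc] at h2
  exact absurd (le_of_mul_le_mul_right h2 (by positivity)) (not_le.2 hK)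

/-! ### Density and mass estimates -/

/-- The radial profile of the densities of `σ(a,b)` and `τ(a,b)`. -/
noncomputable def profile (a b t : ℝ) : ℝ := 1 / (t ^ a * Real.log (Real.exp 1 / t) ^ b)

theorem log_exp_one_div {t : ℝ} (ht : 0 < t) : Real.log (Real.exp 1 / t) = 1 - Real.log t := by
  rw [Real.log_div (Real.exp_ne_zero _) ht.ne', Real.log_exp]

theorem profile_le {b : ℝ} (hb : 0 ≤ b) {m : ℕ} {t : ℝ} (ht1 : (1 / 2 : ℝ) ^ m / 4 ≤ t)
    (ht2 : t ≤ 8 * (1 / 2 : ℝ) ^ m) (ht : t ≤ 2) :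
    profile 2 b t ≤ 16 * 10 ^ b * 4 ^ m * ((m : ℝ) + 1) ^ (-b) := by
  have hx0 : 0 < (1 / 2 : ℝ) ^ m := by positivity
  have ht0 : 0 < t := by linarith
  have hl2 := Real.log_two_gt_d9
  have hl2' := Real.log_two_lt_d9
  have h1 : Real.log t ≤ Real.log 2 := Real.log_le_log ht0 ht
  have h2 : Real.log t ≤ (3 - m) * Real.log 2 := by
    have := Real.log_le_log ht0 ht2
    rw [Real.log_mul (by norm_num) hx0.ne', Real.log_pow, one_div, Real.log_inv,
      show (8 : ℝ) = 2 ^ 3 by norm_num, Real.log_pow] at this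
    push_cast at this
    linarith
  -- For `m ≤ 2` the left side is at most `0.3 < 1 - log 2`; for larger `m` the bound `1 + (m - 3) *
  -- log 2` is enough.
  have hlog : ((m : ℝ) + 1) / 10 ≤ Real.log (Real.exp 1 / t) := by
    rw [log_exp_one_div ht0]
    rcases lt_or_ge m 3 with hm | hm
    · have : (m : ℝ) ≤ 2 := by exact_mod_cast Nat.lt_succ_iff.1 hm
      linarith
    · have : (3 : ℝ) ≤ m := by exact_mod_cast hm
      nlinarith
  have hm0 : 0 < (m : ℝ) + 1 := by positivity
  have hsq : (1 / 16) * (1 / 4 : ℝ) ^ m ≤ t ^ 2 := by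
    have : ((1 / 2 : ℝ) ^ m / 4) ^ 2 = (1 / 16) * (1 / 4 : ℝ) ^ m := by
      rw [div_pow, ← pow_mul, mul_comm m 2, pow_mul]; norm_num; ring
    rw [← this]
    gcongr
  have hden : (1 / 16) * (1 / 4 : ℝ) ^ m * (((m : ℝ) + 1) / 10) ^ b
      ≤ t ^ (2 : ℝ) * Real.log (Real.exp 1 / t) ^ b := by
    rw [Real.rpow_two]
    gcongr
  calc profile 2 b t ≤ 1 / ((1 / 16) * (1 / 4 : ℝ) ^ m * (((m : ℝ) + 1) / 10) ^ b) :=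
        one_div_le_one_div_of_le (by positivity) hden
    _ = 16 * 10 ^ b * 4 ^ m * ((m : ℝ) + 1) ^ (-b) := by
        rw [Real.div_rpow hm0.le (by norm_num), Real.rpow_neg hm0.le, one_div_pow]
        field_simp

/-- For `t ≤ 1` the logarithm is at least `1`, so a negative exponent `b` may be replaced by `0`;
hence `max b 0`. -/
theorem exists_le_profile_two (b : ℝ) : ∃ c : ℝ, 0 < c ∧ ∀ n : ℕ, ∀ t : ℝ,
    (1 / 2 : ℝ) ^ n / 2 ≤ t → t ≤ 4 * (1 / 2 : ℝ) ^ n → t ≤ 1 →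
      c * 4 ^ n * ((n : ℝ) + 1) ^ (-max b 0) ≤ profile 2 b t := by
  set β := max b 0
  have hβ : 0 ≤ β := le_max_right _ _
  refine ⟨1 / (16 * 2 ^ β), by positivity, fun n t ht1 ht2 ht => ?_⟩
  have hx0 : 0 < (1 / 2 : ℝ) ^ n := by positivity
  have ht0 : 0 < t := by linarith
  have hn0 : 0 < (n : ℝ) + 1 := by positivity
  have hL : Real.log (Real.exp 1 / t) = 1 - Real.log t := log_exp_one_div ht0
  have hL1 : 1 ≤ Real.log (Real.exp 1 / t) := by linarith [Real.log_nonpos ht0.le ht]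
  have hLn : Real.log (Real.exp 1 / t) ≤ 2 * ((n : ℝ) + 1) := by
    have := Real.log_le_log (by positivity) ht1
    rw [Real.log_div hx0.ne' (by norm_num), Real.log_pow, one_div, Real.log_inv] at this
    have hl2 := Real.log_two_lt_d9
    rw [hL]
    nlinarith
  have hLb : Real.log (Real.exp 1 / t) ^ b ≤ (2 * ((n : ℝ) + 1)) ^ β :=
    (Real.rpow_le_rpow_of_exponent_le hL1 (le_max_left _ _)).trans
      (Real.rpow_le_rpow (by linarith) hLn hβ)
  have hsq : t ^ 2 ≤ 16 * (1 / 4 : ℝ) ^ n := by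
    have : (4 * (1 / 2 : ℝ) ^ n) ^ 2 = 16 * (1 / 4 : ℝ) ^ n := by
      rw [mul_pow, ← pow_mul, mul_comm n 2, pow_mul]; norm_num
    rw [← this]
    gcongr
  calc 1 / (16 * 2 ^ β) * 4 ^ n * ((n : ℝ) + 1) ^ (-β)
      = 1 / (16 * (1 / 4 : ℝ) ^ n * (2 * ((n : ℝ) + 1)) ^ β) := by
        rw [Real.mul_rpow (by norm_num) hn0.le, Real.rpow_neg hn0.le, one_div_pow]
        field_simp
    _ ≤ profile 2 b t := by
        refine one_div_le_one_div_of_le ?_ ?_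
        · have : 0 < Real.log (Real.exp 1 / t) := by linarith
          positivity
        · rw [Real.rpow_two]
          have : 0 ≤ Real.log (Real.exp 1 / t) ^ b := Real.rpow_nonneg (by linarith) _
          gcongr

/-- The surplus power `t ^ (a - 2)` beats any power of the logarithm, which reduces `a > 2` to the
case `a = 2`, `b = 0`. -/
theorem exists_le_profile_of_two_lt {a : ℝ} (ha : 2 < a) (b : ℝ) : ∃ c : ℝ, 0 < c ∧
    ∀ t : ℝ, 0 < t → t ≤ 1 → c * profile 2 0 t ≤ profile a b t := by
  -- A positive exponent is needed in order to divide `a - 2` by it.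
  set β := max b 1
  have hβ : 0 < β := lt_of_lt_of_le one_pos (le_max_right _ _)
  set s := (a - 2) / β
  have hs : 0 < s := div_pos (by linarith) hβ
  set C := Real.exp 1 ^ (a - 2) / s ^ β
  have hC : 0 < C := by positivity
  refine ⟨1 / C, by positivity, fun t ht0 ht => ?_⟩
  have hL1 : 1 ≤ Real.log (Real.exp 1 / t) := by
    rw [log_exp_one_div ht0]; linarith [Real.log_nonpos ht0.le ht]
  have hL0 : 0 < Real.log (Real.exp 1 / t) := by linarith
  have hLb : Real.log (Real.exp 1 / t) ^ b ≤ Real.exp 1 ^ (a - 2) / t ^ (a - 2) / s ^ β := by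
    refine (Real.rpow_le_rpow_of_exponent_le hL1 (le_max_left b 1)).trans ?_
    have h1 := Real.log_le_rpow_div (x := Real.exp 1 / t) (by positivity) hs
    refine (Real.rpow_le_rpow hL0.le h1 hβ.le).trans (le_of_eq ?_)
    rw [Real.div_rpow (by positivity) hs.le, ← Real.rpow_mul (by positivity),
      div_mul_cancel₀ _ hβ.ne', Real.div_rpow (Real.exp_pos 1).le ht0.le]
  have hden : t ^ a * Real.log (Real.exp 1 / t) ^ b ≤ C * t ^ (2 : ℝ) := by
    have e : t ^ a = t ^ (2 : ℝ) * t ^ (a - 2) := by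
      rw [← Real.rpow_add ht0]; congr 1; ring
    calc t ^ a * Real.log (Real.exp 1 / t) ^ b
        ≤ t ^ (2 : ℝ) * t ^ (a - 2) * (Real.exp 1 ^ (a - 2) / t ^ (a - 2) / s ^ β) := by
          rw [e]; gcongr
      _ = C * t ^ (2 : ℝ) := by
          have : t ^ (a - 2) ≠ 0 := by positivity
          have : s ^ β ≠ 0 := by positivity
          simp only [C]
          field_simp
  calc 1 / C * profile 2 0 t = 1 / (C * t ^ (2 : ℝ)) := by
        rw [profile, Real.rpow_zero, mul_one, div_mul_div_comm, one_mul]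
    _ ≤ profile a b t := one_div_le_one_div_of_le (by positivity) hden

theorem measurableSet_disc : MeasurableSet disc := Metric.isOpen_ball.measurableSet

theorem measurableSet_stolzRegion (ζ : ℂ) : MeasurableSet (stolzRegion ζ) :=
  measurableSet_disc.inter (measurableSet_lt (f := fun z : ℂ => ‖ζ - z‖ / (1 - ‖z‖)) (by fun_prop)
    measurable_const)

theorem normalizedArea_ball {p : ℂ} {r : ℝ} (hr : 0 ≤ r) (hsub : Metric.ball p r ⊆ disc) :
    normalizedArea (Metric.ball p r) = ENNReal.ofReal (r ^ 2) := by
  rw [normalizedArea, Measure.smul_apply, Measure.restrict_apply Metric.isOpen_ball.measurableSet,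
    inter_eq_left.2 hsub, Complex.volume_ball, smul_eq_mul, ← ENNReal.ofReal_pow hr,
    ← ENNReal.ofReal_coe_nnreal, NNReal.coe_real_pi, ← ENNReal.ofReal_mul (by positivity),
    ← ENNReal.ofReal_mul (by positivity)]
  congr 1
  have := Real.pi_ne_zero
  field_simp

theorem normalizedArea_closedBall_le (p : ℂ) {r : ℝ} (hr : 0 ≤ r) :
    normalizedArea (Metric.closedBall p r) ≤ ENNReal.ofReal (r ^ 2) := by
  rw [normalizedArea, Measure.smul_apply, smul_eq_mul]
  refine (mul_le_mul_right (Measure.restrict_apply_le _ _) _).trans (le_of_eq ?_)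
  rw [Complex.volume_closedBall, ← ENNReal.ofReal_pow hr,
    ← ENNReal.ofReal_coe_nnreal, NNReal.coe_real_pi, ← ENNReal.ofReal_mul (by positivity),
    ← ENNReal.ofReal_mul (by positivity)]
  congr 1
  have := Real.pi_ne_zero
  field_simp

theorem withDensity_apply_le_mul {ν : Measure ℂ} {f : ℂ → ℝ≥0∞} {A : Set ℂ} {c : ℝ≥0∞}
    (hA : MeasurableSet A) (h : ∀ z ∈ A, f z ≤ c) : ν.withDensity f A ≤ c * ν A := by
  rw [withDensity_apply _ hA, ← setLIntegral_const]
  exact setLIntegral_mono' hA h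

theorem mul_le_withDensity_apply {ν : Measure ℂ} {f : ℂ → ℝ≥0∞} {A : Set ℂ} {c : ℝ≥0∞}
    (hA : MeasurableSet A) (h : ∀ z ∈ A, c ≤ f z) : c * ν A ≤ ν.withDensity f A := by
  rw [withDensity_apply _ hA, ← setLIntegral_const]
  exact setLIntegral_mono' hA h

theorem one_sub_norm_sq_le (z : ℂ) : 1 - ‖z‖ ^ 2 ≤ 2 * (1 - ‖z‖) := by
  nlinarith [sq_nonneg (1 - ‖z‖)]

theorem one_sub_norm_le_one_sub_norm_sq {z : ℂ} (hz : z ∈ disc) : 1 - ‖z‖ ≤ 1 - ‖z‖ ^ 2 := by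
  nlinarith [norm_nonneg z, norm_lt_one_of_mem_disc hz]

/-- Upper bound for the masses of sets at distance about `2 ^ (-m)` from `1`. -/
theorem exists_measure_le {b : ℝ} (hb : 0 ≤ b) {μ : Measure ℂ}
    (hμ : μ = sigmaMeasure 2 b ∨ μ = tauMeasure 2 b) : ∃ C : ℝ, 0 ≤ C ∧
      ∀ m : ℕ, ∀ A : Set ℂ, MeasurableSet A → A ⊆ disc →
        (∀ z ∈ A, (1 / 2 : ℝ) ^ m / 2 ≤ ‖1 - z‖ ∧ ‖1 - z‖ ≤ 4 * (1 / 2 : ℝ) ^ m) →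
        μ A ≤ ENNReal.ofReal (C * 4 ^ m * ((m : ℝ) + 1) ^ (-b)) * normalizedArea A := by
  refine ⟨16 * 10 ^ b, by positivity, fun m A hA hAd hAm => ?_⟩
  have hx0 : 0 < (1 / 2 : ℝ) ^ m := by positivity
  rcases hμ with rfl | rfl
  · refine withDensity_apply_le_mul hA fun z hz => ENNReal.ofReal_le_ofReal ?_
    obtain ⟨h1, h2⟩ := hAm z hz
    exact profile_le hb (by linarith) (by linarith) (norm_one_sub_lt_two (hAd hz)).le
  · rw [tauMeasure, Measure.restrict_apply hA]
    refine (withDensity_apply_le_mul (hA.inter (measurableSet_stolzRegion 1)) fun z hz =>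
      ENNReal.ofReal_le_ofReal ?_).trans (mul_le_mul_right (measure_mono inter_subset_left) _)
    obtain ⟨h1, h2⟩ := hAm z hz.1
    have hz1 := norm_lt_one_of_mem_disc (hAd hz.1)
    -- In the Stolz region `1 - |z|` is comparable to `|1 - z|`, which accounts for the constants `1
    -- / 4` and `8` in `profile_le`.
    have h3 := hz.2.2
    rw [div_lt_iff₀ (by linarith)] at h3
    have h4 := one_sub_norm_sq_le z
    have h5 := one_sub_norm_le_one_sub_norm_sq (hAd hz.1)
    have h6 := one_sub_norm_le z
    exact profile_le hb (by linarith) (by linarith) (by linarith [norm_nonneg z])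

/-- Lower bound for the masses of the discs `realBall ε n`. -/
theorem exists_le_measure_realBall {a b β : ℝ} (hab : 2 < a ∧ β = 0 ∨ a = 2 ∧ β = max b 0)
    {μ : Measure ℂ} (hμ : μ = sigmaMeasure a b ∨ μ = tauMeasure a b) {ε : ℝ} (hε0 : 0 < ε)
    (hε : ε ≤ 1 / 8) : ∃ c : ℝ, 0 < c ∧ ∀ n : ℕ, 1 ≤ n →
      ENNReal.ofReal (c * ((n : ℝ) + 1) ^ (-β)) ≤ μ (realBall ε n) := by
  obtain ⟨c, hc, hprof⟩ : ∃ c : ℝ, 0 < c ∧ ∀ n : ℕ, ∀ t : ℝ,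
      (1 / 2 : ℝ) ^ n / 2 ≤ t → t ≤ 4 * (1 / 2 : ℝ) ^ n → t ≤ 1 →
        c * 4 ^ n * ((n : ℝ) + 1) ^ (-β) ≤ profile a b t := by
    rcases hab with ⟨ha, rfl⟩ | ⟨rfl, rfl⟩
    · obtain ⟨c, hc, h⟩ := exists_le_profile_two 0
      obtain ⟨d, hd, h'⟩ := exists_le_profile_of_two_lt ha b
      refine ⟨d * c, by positivity, fun n t h1 h2 h3 => ?_⟩
      have h4 := h n t h1 h2 h3
      rw [max_self] at h4
      refine le_trans ?_ (h' t (lt_of_lt_of_le (by positivity) h1) h3)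
      rw [mul_assoc d, mul_assoc d]
      gcongr
    · exact exists_le_profile_two b
  refine ⟨c * ε ^ 2, by positivity, fun n hn => ?_⟩
  set x : ℝ := (1 / 2 : ℝ) ^ n with hx
  have hx0 : 0 < x := by positivity
  have hx1 : x ≤ 1 / 2 := by
    have := pow_le_pow_of_le_one (a := (1 / 2 : ℝ)) (by norm_num) (by norm_num) hn
    rwa [pow_one] at this
  have hball : MeasurableSet (realBall ε n) := Metric.isOpen_ball.measurableSet
  -- The ratio `|1 - z| / (1 - |z|)` is below `(9 / 8) / (7 / 8) < 2`, so the discs lie in the Stolz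
  -- region and the restriction in `τ` costs nothing.
  have hbounds : ∀ z ∈ realBall ε n, z ∈ stolzRegion 1 ∧ x / 2 ≤ ‖1 - z‖ ∧ ‖1 - z‖ ≤ 4 * x ∧
      ‖1 - z‖ ≤ 1 ∧ x / 2 ≤ 1 - ‖z‖ ^ 2 ∧ 1 - ‖z‖ ^ 2 ≤ 4 * x := by
    intro z hz
    have hzd := realBall_subset_disc hε n hz
    have h1 := norm_lt_of_mem_realBall hz
    have h2 := norm_one_sub_lt_of_mem_realBall hz
    rw [← hx] at h1 h2
    have h3 := one_sub_norm_le z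
    have h4 := one_sub_norm_sq_le z
    have h5 := one_sub_norm_le_one_sub_norm_sq hzd
    have hz1 := norm_lt_one_of_mem_disc hzd
    have h6 : 7 / 8 * x ≤ (1 - ε) * x := by gcongr; linarith
    have h7 : (1 + ε) * x ≤ 9 / 8 * x := by gcongr; linarith
    refine ⟨⟨hzd, ?_⟩, by linarith, by linarith, by linarith, by linarith, by linarith⟩
    rw [div_lt_iff₀ (by linarith)]
    linarith
  have hvol : ENNReal.ofReal (c * ε ^ 2 * ((n : ℝ) + 1) ^ (-β))
      = ENNReal.ofReal (c * 4 ^ n * ((n : ℝ) + 1) ^ (-β)) * normalizedArea (realBall ε n) := by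
    have hsub := realBall_subset_disc hε n
    rw [realBall] at hsub ⊢
    rw [normalizedArea_ball (by positivity) hsub, ← ENNReal.ofReal_mul (by positivity)]
    congr 1
    have : (4 : ℝ) ^ n * ((1 / 2 : ℝ) ^ n) ^ 2 = 1 := by
      rw [← pow_mul, mul_comm n 2, pow_mul, ← mul_pow]; norm_num
    linear_combination (-c * ε ^ 2 * ((n : ℝ) + 1) ^ (-β)) * this
  rw [hvol]
  rcases hμ with rfl | rfl
  · refine mul_le_withDensity_apply hball fun z hz => ENNReal.ofReal_le_ofReal ?_
    obtain ⟨-, h1, h2, h3, -, -⟩ := hbounds z hz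
    exact hprof n _ h1 h2 h3
  · rw [tauMeasure, Measure.restrict_apply hball,
      inter_eq_left.2 fun z hz => (hbounds z hz).1]
    refine mul_le_withDensity_apply hball fun z hz => ENNReal.ofReal_le_ofReal ?_
    obtain ⟨-, -, -, -, h1, h2⟩ := hbounds z hz
    exact hprof n _ h1 h2 (by linarith [sq_nonneg ‖z‖])

/-! ### Almost sure statements -/

section

variable {Ω : Type*} [MeasurableSpace Ω] {P : Measure Ω} [IsProbabilityMeasure P]
  {μ : Measure ℂ} {Λ : Ω → DiscSequence}

theorem ae_exists_count_realBall_ge (hΛ : IsPoissonProcess P μ Λ) {a b β : ℝ}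
    (hab : 2 < a ∧ β = 0 ∨ a = 2 ∧ β = max b 0)
    (hμ : μ = sigmaMeasure a b ∨ μ = tauMeasure a b) {ε : ℝ} (hε0 : 0 < ε) (hε : ε ≤ 1 / 8)
    {K : ℕ} (hβK : β * K ≤ 1) :
    ∀ᵐ ω ∂P, ∃ n, 1 ≤ n ∧ (K : ℕ∞) ≤ (Λ ω).count (realBall ε n) := by
  have hβ : 0 ≤ β := by
    rcases hab with ⟨-, rfl⟩ | ⟨-, rfl⟩
    · exact le_rfl
    · exact le_max_right _ _
  obtain ⟨c, hc, hlow⟩ := exists_le_measure_realBall hab hμ hε0 hε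
  -- The shift to `n + 1` discards the disc centred at `0`; the factor `2 ^ (-β)` comes from `n + 2
  -- ≤ 2 * (n + 1)`.
  have h := hΛ.ae_exists_count_ge (A := fun n => realBall ε (n + 1))
    (fun _ => Metric.isOpen_ball.measurableSet) (fun n => realBall_subset_disc hε _)
    (fun i j hij => disjoint_realBall hε (by omega)) (K := K) (c := c * 2 ^ (-β)) (by positivity)
    hβ hβK (fun n => (ENNReal.ofReal_le_ofReal ?_).trans (hlow (n + 1) (by omega)))
  · exact h.mono fun ω ⟨n, hn⟩ => ⟨n + 1, by omega, hn⟩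
  · rw [mul_assoc, ← Real.mul_rpow (by norm_num) (by positivity)]
    push_cast
    refine mul_le_mul_of_nonneg_left (Real.rpow_le_rpow_of_nonpos (by positivity) ?_
      (by linarith)) hc.le
    have : (0 : ℝ) ≤ n := n.cast_nonneg
    linarith

theorem ae_not_isUnionOfSeparated (hΛ : IsPoissonProcess P μ Λ) {a b β : ℝ}
    (hab : 2 < a ∧ β = 0 ∨ a = 2 ∧ β = max b 0)
    (hμ : μ = sigmaMeasure a b ∨ μ = tauMeasure a b) {M : ℕ} (hβM : β * ((M : ℝ) + 1) ≤ 1) :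
    ∀ᵐ ω ∂P, ¬ (Λ ω).IsUnionOfSeparated M := by
  -- A countable family of radii tending to `0` lets one null set serve all `δ`.
  have h : ∀ᵐ ω ∂P, ∀ i : ℕ, ∃ n, 1 ≤ n ∧
      ((M + 1 : ℕ) : ℕ∞) ≤ (Λ ω).count (realBall ((1 / 8) * (1 / 2 : ℝ) ^ i) n) :=
    ae_all_iff.2 fun i => ae_exists_count_realBall_ge hΛ hab hμ (by positivity)
      (mul_le_of_le_one_right (by norm_num) (pow_le_one₀ (by norm_num) (by norm_num)))
      (by exact_mod_cast hβM)
  filter_upwards [h] with ω hω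
  refine DiscSequence.not_isUnionOfSeparated fun δ hδ => ?_
  obtain ⟨i, hi⟩ := exists_pow_lt_of_lt_one hδ (show (1 / 2 : ℝ) < 1 by norm_num)
  obtain ⟨n, -, hn⟩ := hω i
  refine ⟨_, hn, fun z hz w hw => (pseudoDist_lt_of_mem_realBall
    (mul_le_of_le_one_right (by norm_num) (pow_le_one₀ (by norm_num) (by norm_num)))
    hz hw).trans ?_⟩
  have : 0 < (1 / 2 : ℝ) ^ i := by positivity
  linarith

theorem ae_forall_not_isCarleson (hΛ : IsPoissonProcess P μ Λ) {a b : ℝ} (ha : 2 < a)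
    (hμ : μ = sigmaMeasure a b ∨ μ = tauMeasure a b) :
    ∀ᵐ ω ∂P, ∀ α : ℝ, 0 < α → α ≤ 1 → ¬ (Λ ω).IsCarleson α := by
  have h : ∀ᵐ ω ∂P, ∀ K : ℕ, ∃ n, 1 ≤ n ∧ (K : ℕ∞) ≤ (Λ ω).count (realBall (1 / 8) n) :=
    ae_all_iff.2 fun K => ae_exists_count_realBall_ge hΛ (Or.inl ⟨ha, rfl⟩) hμ (by norm_num)
      le_rfl (by simp)
  filter_upwards [h] with ω hω α hα _
  exact DiscSequence.not_isCarleson le_rfl hω hα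

theorem measurableSet_annulus (m : ℕ) : MeasurableSet (annulus m) :=
  measurableSet_disc.inter
    ((measurableSet_lt (g := fun z : ℂ => ‖1 - z‖) measurable_const (by fun_prop)).inter
    (measurableSet_le (f := fun z : ℂ => ‖1 - z‖) (by fun_prop) measurable_const))

theorem ae_isCarleson (hΛ : IsPoissonProcess P μ Λ) {b : ℝ} (hb : 0 < b)
    (hμ : μ = sigmaMeasure 2 b ∨ μ = tauMeasure 2 b) {α : ℝ} (hα : 0 < α) :
    ∀ᵐ ω ∂P, (Λ ω).IsCarleson α := by
  obtain ⟨C, hC, hup⟩ := exists_measure_le hb.le hμ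
  have h := hΛ.ae_exists_forall_count_le (X := annulus) measurableSet_annulus
    (fun m z hz => hz.1) (C := 4 * C) (by positivity) hb (fun m => ?_)
  · filter_upwards [h] with ω ⟨K, hK⟩
    exact DiscSequence.isCarleson_of_count_annulus_le hK hα
  · have hx0 : 0 < (1 / 2 : ℝ) ^ m := by positivity
    have hsub : annulus m ⊆ Metric.closedBall 1 (2 * (1 / 2 : ℝ) ^ m) := fun z hz => by
      rw [mem_closedBall_iff_norm, norm_sub_rev]; exact hz.2.2
    calc μ (annulus m)
        ≤ ENNReal.ofReal (C * 4 ^ m * ((m : ℝ) + 1) ^ (-b)) * normalizedArea (annulus m) :=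
          hup m _ (measurableSet_annulus m) (fun z hz => hz.1)
            fun z hz => ⟨by linarith [hz.2.1], by linarith [hz.2.2]⟩
      _ ≤ ENNReal.ofReal (C * 4 ^ m * ((m : ℝ) + 1) ^ (-b))
            * ENNReal.ofReal ((2 * (1 / 2 : ℝ) ^ m) ^ 2) := by
          gcongr
          exact (measure_mono hsub).trans (normalizedArea_closedBall_le _ (by positivity))
      _ = ENNReal.ofReal (4 * C * ((m : ℝ) + 1) ^ (-b)) := by
          rw [← ENNReal.ofReal_mul (by positivity)]
          congr 1
          have : (4 : ℝ) ^ m * ((1 / 2 : ℝ) ^ m) ^ 2 = 1 := by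
            rw [← pow_mul, mul_comm m 2, pow_mul, ← mul_pow]; norm_num
          linear_combination (4 * C * ((m : ℝ) + 1) ^ (-b)) * this

theorem measurableSet_cell (m j k : ℕ) (u v : ℤ) : MeasurableSet (cell m j k u v) :=
  measurableSet_disc.inter
    ((measurableSet_le (g := fun z : ℂ => ‖1 - z‖) measurable_const (by fun_prop)).inter
    ((measurableSet_le (f := fun z : ℂ => ‖1 - z‖) (by fun_prop) measurable_const).inter
    Metric.isClosed_closedBall.measurableSet))

theorem exists_measure_cell_le {b : ℝ} (hb : 0 ≤ b)
    (hμ : μ = sigmaMeasure 2 b ∨ μ = tauMeasure 2 b) : ∃ D : ℝ, 0 ≤ D ∧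
      ∀ (m j k : ℕ) (u v : ℤ), μ (cell m j k u v)
        ≤ ENNReal.ofReal (D * ((m : ℝ) + 1) ^ (-b) * (1 / 4 : ℝ) ^ (j + k)) := by
  obtain ⟨C, hC, hup⟩ := exists_measure_le hb hμ
  refine ⟨4 * C, by positivity, fun m j k u v => ?_⟩
  refine (hup m _ (measurableSet_cell m j k u v) (fun z hz => hz.1)
    fun z hz => ⟨hz.2.1, hz.2.2.1⟩).trans ?_
  refine (mul_le_mul_right ((measure_mono fun z hz => hz.2.2.2).trans
    (normalizedArea_closedBall_le _ (by positivity))) _).trans (le_of_eq ?_)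
  rw [← ENNReal.ofReal_mul (by positivity)]
  congr 1
  have h1 : (4 : ℝ) ^ m * (1 / 4 : ℝ) ^ m = 1 := by rw [← mul_pow]; norm_num
  have h2 : ((1 / 2 : ℝ) ^ (m + j + k)) ^ 2 = (1 / 4 : ℝ) ^ m * (1 / 4 : ℝ) ^ (j + k) := by
    rw [← pow_mul, mul_comm _ 2, pow_mul, add_assoc, ← pow_add]; norm_num
  rw [mul_pow, h2]
  linear_combination (4 * C * ((m : ℝ) + 1) ^ (-b) * (1 / 4 : ℝ) ^ (j + k)) * h1

theorem card_gridRange_le (n : ℕ) : (gridRange n).card ≤ 16 * 2 ^ n := by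
  rw [gridRange, Int.card_Icc, pow_add]
  have : (1 : ℤ) ≤ 2 ^ n := one_le_pow₀ (by norm_num)
  zify
  omega

/-- The event that some cell of resolution `k` contains more than `M` points. -/
def crowded (Λ : Ω → DiscSequence) (M k : ℕ) : Set Ω :=
  ⋃ (m : ℕ) (j : ℕ), ⋃ u ∈ gridRange (j + k), ⋃ v ∈ gridRange (j + k),
    {ω | ((M + 1 : ℕ) : ℕ∞) ≤ (Λ ω).count (cell m j k u v)}

/-- A union bound: the sum over `m` converges because `b * (M + 1) > 1`, and the sum over `j`
because the factor `4 ^ (-(j + k) * (M + 1))` outweighs the at most `256 * 4 ^ (j + k)` cells. -/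
theorem exists_prob_crowded_le (hΛ : IsPoissonProcess P μ Λ) {b : ℝ} {M : ℕ} (hM : 1 ≤ M)
    (hb : 1 / ((M : ℝ) + 1) < b) (hμ : μ = sigmaMeasure 2 b ∨ μ = tauMeasure 2 b) :
    ∃ F : ℝ≥0∞, F ≠ ⊤ ∧ ∀ k, P (crowded Λ M k) ≤ F * ENNReal.ofReal ((1 / 4 : ℝ) ^ k) := by
  have hM0 : 0 < (M : ℝ) + 1 := by positivity
  have hb0 : 0 < b := lt_trans (by positivity) hb
  have hbM : 1 < b * ((M : ℝ) + 1) := by rwa [div_lt_iff₀ hM0] at hb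
  obtain ⟨D, hD, hcell⟩ := exists_measure_cell_le hb0.le hμ
  have hs1 : Summable fun m : ℕ => 256 * D ^ (M + 1) * ((m : ℝ) + 1) ^ (-b * ((M : ℝ) + 1)) := by
    have := ((summable_nat_add_iff 1).2 (Real.summable_nat_rpow (p := -b * ((M : ℝ) + 1))|>.2
      (by linarith))).mul_left (256 * D ^ (M + 1))
    refine this.congr fun n => ?_
    push_cast
    rfl
  have hs2 : Summable fun j : ℕ => (1 / 4 : ℝ) ^ j :=
    summable_geometric_of_lt_one (by norm_num) (by norm_num)
  refine ⟨(∑' m : ℕ, ENNReal.ofReal (256 * D ^ (M + 1) * ((m : ℝ) + 1) ^ (-b * ((M : ℝ) + 1))))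
    * ∑' j : ℕ, ENNReal.ofReal ((1 / 4 : ℝ) ^ j),
    ENNReal.mul_ne_top hs1.tsum_ofReal_ne_top hs2.tsum_ofReal_ne_top, fun k => ?_⟩
  have hlevel : ∀ m j : ℕ, P (⋃ u ∈ gridRange (j + k), ⋃ v ∈ gridRange (j + k),
      {ω | ((M + 1 : ℕ) : ℕ∞) ≤ (Λ ω).count (cell m j k u v)})
      ≤ ENNReal.ofReal (256 * D ^ (M + 1) * ((m : ℝ) + 1) ^ (-b * ((M : ℝ) + 1)))
        * (ENNReal.ofReal ((1 / 4 : ℝ) ^ j) * ENNReal.ofReal ((1 / 4 : ℝ) ^ k)) := by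
    intro m j
    set y : ℝ := D * ((m : ℝ) + 1) ^ (-b) * (1 / 4 : ℝ) ^ (j + k) with hy
    have hy0 : 0 ≤ y := by positivity
    have hone : ∀ u v, P {ω | ((M + 1 : ℕ) : ℕ∞) ≤ (Λ ω).count (cell m j k u v)}
        ≤ ENNReal.ofReal (y ^ (M + 1)) := by
      intro u v
      rw [ENNReal.ofReal_pow hy0]
      refine (hΛ.prob_count_ge_le (measurableSet_cell m j k u v) (fun z hz => hz.1)
        M.succ_ne_zero).trans ?_
      gcongr
      exact hcell m j k u v
    set N := (gridRange (j + k)).card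
    calc P (⋃ u ∈ gridRange (j + k), ⋃ v ∈ gridRange (j + k),
          {ω | ((M + 1 : ℕ) : ℕ∞) ≤ (Λ ω).count (cell m j k u v)})
        ≤ ∑ u ∈ gridRange (j + k), ∑ v ∈ gridRange (j + k), ENNReal.ofReal (y ^ (M + 1)) :=
          (measure_biUnion_finset_le _ _).trans (Finset.sum_le_sum fun u _ =>
            (measure_biUnion_finset_le _ _).trans (Finset.sum_le_sum fun v _ => hone u v))
      _ = ENNReal.ofReal (N * (N * y ^ (M + 1))) := by
          rw [Finset.sum_const, Finset.sum_const, nsmul_eq_mul, nsmul_eq_mul,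
            ENNReal.ofReal_mul (by positivity), ENNReal.ofReal_mul (by positivity),
            ENNReal.ofReal_natCast]
      _ ≤ ENNReal.ofReal (256 * D ^ (M + 1) * ((m : ℝ) + 1) ^ (-b * ((M : ℝ) + 1))
            * ((1 / 4 : ℝ) ^ j * (1 / 4 : ℝ) ^ k)) := by
          refine ENNReal.ofReal_le_ofReal ?_
          have hN : (N : ℝ) ≤ 16 * 2 ^ (j + k) := by exact_mod_cast card_gridRange_le (j + k)
          have hpow : (((m : ℝ) + 1) ^ (-b)) ^ (M + 1)
              = ((m : ℝ) + 1) ^ (-b * ((M : ℝ) + 1)) := by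
            rw [← Real.rpow_natCast, ← Real.rpow_mul (by positivity)]
            push_cast
            rfl
          -- Counting the cells uses up one of the `M + 1` factors; `M ≥ 1` leaves at least one for
          -- summability in `j` and decay in `k`.
          have hq : ((1 / 4 : ℝ) ^ (j + k)) ^ M ≤ (1 / 4 : ℝ) ^ (j + k) :=
            pow_le_of_le_one (by positivity) (pow_le_one₀ (by norm_num) (by norm_num)) (by omega)
          have h2 : (2 : ℝ) ^ (j + k) * 2 ^ (j + k) * (1 / 4 : ℝ) ^ (j + k) = 1 := by
            rw [← mul_pow, ← mul_pow]; norm_num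
          calc (N : ℝ) * (N * y ^ (M + 1))
              ≤ 16 * 2 ^ (j + k) * (16 * 2 ^ (j + k) * y ^ (M + 1)) := by gcongr
            _ = 256 * D ^ (M + 1) * ((m : ℝ) + 1) ^ (-b * ((M : ℝ) + 1))
                * ((1 / 4 : ℝ) ^ (j + k)) ^ M := by
              rw [hy, mul_pow, mul_pow, hpow, pow_succ ((1 / 4 : ℝ) ^ (j + k))]
              linear_combination (256 * D ^ (M + 1) * ((m : ℝ) + 1) ^ (-b * ((M : ℝ) + 1))
                * ((1 / 4 : ℝ) ^ (j + k)) ^ M) * h2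
            _ ≤ _ := by
              rw [← pow_add]
              gcongr
      _ = _ := by
          rw [ENNReal.ofReal_mul (by positivity), ENNReal.ofReal_mul (p := (1 / 4 : ℝ) ^ j)
            (by positivity)]
  calc P (crowded Λ M k)
      ≤ ∑' m : ℕ, ∑' j : ℕ,
          ENNReal.ofReal (256 * D ^ (M + 1) * ((m : ℝ) + 1) ^ (-b * ((M : ℝ) + 1)))
          * (ENNReal.ofReal ((1 / 4 : ℝ) ^ j) * ENNReal.ofReal ((1 / 4 : ℝ) ^ k)) :=
        (measure_iUnion_le _).trans (ENNReal.tsum_le_tsum fun m =>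
          (measure_iUnion_le _).trans (ENNReal.tsum_le_tsum fun j => hlevel m j))
    _ = _ := by
        simp_rw [ENNReal.tsum_mul_left, ENNReal.tsum_mul_right]
        rw [mul_assoc]

theorem ae_isUnionOfSeparated (hΛ : IsPoissonProcess P μ Λ) {b : ℝ} {M : ℕ} (hM : 1 ≤ M)
    (hb : 1 / ((M : ℝ) + 1) < b) (hμ : μ = sigmaMeasure 2 b ∨ μ = tauMeasure 2 b) :
    ∀ᵐ ω ∂P, (Λ ω).IsUnionOfSeparated M := by
  obtain ⟨F, hF, hprob⟩ := exists_prob_crowded_le hΛ hM hb hμ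
  -- Crowding at every resolution is null. The shift `k + 1` meets the requirement `1 ≤ k` on
  -- resolutions.
  have hnull : P (⋂ k, crowded Λ M (k + 1)) = 0 := by
    have hlim : Tendsto (fun k : ℕ => F * ENNReal.ofReal ((1 / 4 : ℝ) ^ (k + 1))) atTop (𝓝 0) := by
      have h1 := (tendsto_pow_atTop_nhds_zero_of_lt_one (r := (1 / 4 : ℝ)) (by norm_num)
        (by norm_num)).comp (tendsto_add_atTop_nat 1)
      have h2 := ENNReal.Tendsto.const_mul (a := F) (ENNReal.tendsto_ofReal h1) (Or.inr hF)
      rwa [ENNReal.ofReal_zero, mul_zero] at h2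
    exact le_antisymm (ge_of_tendsto' hlim fun k =>
      (measure_mono (iInter_subset _ k)).trans (hprob (k + 1))) zero_le
  filter_upwards [measure_eq_zero_iff_ae_notMem.1 hnull] with ω hω
  obtain ⟨k, hk⟩ := not_forall.1 (mt mem_iInter.2 hω)
  refine DiscSequence.isUnionOfSeparated_of_forall_cell hM (k := k + 1) (by omega)
    fun m j u hu v hv => ?_
  by_contra! hlt
  refine hk (mem_iUnion.2 ⟨m, mem_iUnion.2 ⟨j, mem_biUnion hu (mem_biUnion hv ?_)⟩⟩)
  exact Order.add_one_le_of_lt hlt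

end

end PoissonDisc

theorem mainTheorem8 {Ω : Type*} [MeasurableSpace Ω] (P : Measure Ω) [IsProbabilityMeasure P]
    (a b : ℝ) (hab : 2 < a ∨ (a = 2 ∧ b ≤ 1))
    (μ : Measure ℂ)
    (hμ : μ = PoissonDisc.sigmaMeasure a b ∨ μ = PoissonDisc.tauMeasure a b)
    (Λ : Ω → PoissonDisc.DiscSequence) (hΛ : PoissonDisc.IsPoissonProcess P μ Λ) :
    (2 < a → ∀ᵐ ω ∂P,
      (∀ M : ℕ, ¬ (Λ ω).IsUnionOfSeparated M) ∧
      (∀ α : ℝ, 0 < α → α ≤ 1 → ¬ (Λ ω).IsCarleson α)) ∧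
    (a = 2 →
      (∀ M : ℕ, 1 ≤ M →
        ((∀ᵐ ω ∂P, (Λ ω).IsUnionOfSeparated M) ↔ 1 / ((M : ℝ) + 1) < b) ∧
        (b ≤ 1 / ((M : ℝ) + 1) → ∀ᵐ ω ∂P, ¬ (Λ ω).IsUnionOfSeparated M)) ∧
      (∀ α : ℝ, 0 < α → α < 1 → 1 - α < b → ∀ᵐ ω ∂P, (Λ ω).IsCarleson α)) := by
  refine ⟨fun ha => ?_, fun ha => ?_⟩
  · exact (ae_all_iff.2 fun M => PoissonDisc.ae_not_isUnionOfSeparated hΛ (Or.inl ⟨ha, rfl⟩) hμ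
      (by simp)).and (PoissonDisc.ae_forall_not_isCarleson hΛ ha hμ)
  subst ha
  have hneg : ∀ M : ℕ, b ≤ 1 / ((M : ℝ) + 1) → ∀ᵐ ω ∂P, ¬ (Λ ω).IsUnionOfSeparated M := by
    intro M hb
    refine PoissonDisc.ae_not_isUnionOfSeparated hΛ (Or.inr ⟨rfl, rfl⟩) hμ ?_
    rw [← le_div_iff₀ (by positivity)]
    exact max_le hb (by positivity)
  refine ⟨fun M hM => ⟨⟨fun h => ?_, fun h => PoissonDisc.ae_isUnionOfSeparated hΛ hM h hμ⟩,
    hneg M⟩, fun α hα hα1 hb => PoissonDisc.ae_isCarleson hΛ (by linarith) hμ hα⟩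
  -- Two opposite almost sure statements would hold at a common `ω`, as `P` is a probability
  -- measure.
  by_contra! hb
  obtain ⟨ω, h1, h2⟩ := (h.and (hneg M hb)).exists
  exact h2 h1
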